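/- Let $a<b$ be real numbers and let $J$ be an index set. For each $j\in J$ let $N_j\ge 2$ be an integer, let $S^{(j)}_i(x)=r^{(j)}_i x+c^{(j)}_i$ ($i=1,\dots,N_j$) be affine maps with $r^{(j)}_i\in(0,1)$ and $$a=S^{(j)}_1(a)<S^{(j)}_1(b)\le S^{(j)}_2(a)<S^{(j)}_2(b)\le\dots\le S^{(j)}_{N_j}(a)<S^{(j)}_{N_j}(b)=b,$$ and let $m^{(j)}_1,\dots,m^{(j)}_{N_j}>0$ be weights with $\sum_i m^{(j)}_i=1$. Let $I$ be a $J$-labelled tree: it has a root $\emptyset$, every individual $\mathbf i\in I$ carries a label in $J$, again denoted $\mathbf i$, and the children of $\mathbf i=(i_1,\dots,i_n)$ are $(i_1,\dots,i_n,k)$ with $1\le k\le N_{\mathbf i}$. Let $I_n$ be its $n$-th generation and let $\theta_iI$ be the labelled subtree rooted at the child $(i)$ of $\emptyset$. For $\mathbf i=(i_1,\dots,i_n)\in I_n$ put $m_{\mathbf i}=m^{(\emptyset)}_{i_1}m^{((i_1))}_{i_2}\cdots m^{((i_1,\dots,i_{n-1}))}_{i_n}$ and $S_{\mathbf i}=S^{(\emptyset)}_{i_1}\circ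 S^{((i_1))}_{i_2}\circ\cdots\circ S^{((i_1,\dots,i_{n-1}))}_{i_n}$, and let $$\mu^{(I)}_n=\sum_{\mathbf i\in I_n}m_{\mathbf i}\,\mu_0\circ S_{\mathbf i}^{-1},\qquad \mu_0=\frac1{b-a}\,\lambda^1|_{[a,b]},$$ where $\lambda^1$ is Lebesgue measure. The recursive Cantor measure $\mu^{(I)}$ is the weak limit of $(\mu^{(I)}_n)_n$. Let $\mathcal F=H^1([a,b])$ be the space of continuous real functions $f$ on $[a,b]$ with a weak derivative $f'\in L_2(\lambda^1)$, let $\mathcal F_0=\{f\in\mathcal F: f(a)=f(b)=0\}$, and let $\mathcal E(f,g)=\int_a^b f'g'\,dx$. The Neumann (respectively Dirichlet) eigenspace of $\mu^{(I)}$ for $\lambda\in\mathbb R$ consists of all $f\in\mathcal F$ (respectively $f\in\mathcal F_0$) with $\mathcal E(f,g)=\lambda\int_{[a,b]} fg\,d\mu^{(I)}$ for all $g\in\mathcal F$ (respectively $g\in\mathcal F_0$); $\lambda$ is an eigenvalue if this space is non-zero, and its multiplicity is the dimension of this space. Let $N^{(I)}_N(x)$ and $N^{(I)}_D(x)$ be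 the numbers of Neumann and Dirichlet eigenvalues $\lambda\le x$, counted with multiplicity. Then the weak limit $\mu^{(I)}$ exists, and for all $x\ge 0$ $$\sum_{i=1}^{N_\emptyset}N_D^{(\theta_iI)}\big(r^{(\emptyset)}_im^{(\emptyset)}_ix\big)\;\le\;N_D^{(I)}(x)\;\le\;N_N^{(I)}(x)\;\le\;\sum_{i=1}^{N_\emptyset}N_N^{(\theta_iI)}\big(r^{(\emptyset)}_im^{(\emptyset)}_ix\big).$$ -/

import Mathlib

open MeasureTheory Filter Topology

noncomputable section

namespace RecursiveCantor

/-- An iterated function system `S_1, …, S_N` (`N ≥ 2`) of increasing affine contractions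
`S_i x = r_i x + c_i` of `[a, b]`, whose images are ordered from left to right, may touch at
endpoints only, and start at `a` and end at `b`, together with a vector of positive weights
`m_1, …, m_N` of sum `1`. Only the indices `1, …, N` matter. -/
structure WeightedIFS (a b : ℝ) where
  N : ℕ
  r : ℕ → ℝ
  c : ℕ → ℝ
  m : ℕ → ℝ
  two_le_N : 2 ≤ N
  r_mem : ∀ i ∈ Finset.Icc 1 N, r i ∈ Set.Ioo (0 : ℝ) 1
  first_left : r 1 * a + c 1 = a
  last_right : r N * b + c N = b
  ordered : ∀ i, 1 ≤ i → i < N → r i * b + c i ≤ r (i + 1) * a + c (i + 1)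
  m_pos : ∀ i ∈ Finset.Icc 1 N, 0 < m i
  m_sum : ∑ i ∈ Finset.Icc 1 N, m i = 1

/-- The contraction `S_i`. -/
def WeightedIFS.map {a b : ℝ} (s : WeightedIFS a b) (i : ℕ) (x : ℝ) : ℝ :=
  s.r i * x + s.c i

section Tree

variable {a b : ℝ} {J : Type*}

/-- Individuals are finite words `(i_1, …, i_n)`, the ancestor is `[]`, and `I w : J` is the label
of the individual `w`. Labels of words that are never born (see `generation`) play no role.
`subtree I i` is the tree `θ_i I` rooted at the child `(i)` of the ancestor. -/
def subtree (I : List ℕ → J) (i : ℕ) : List ℕ → J := fun w => I (i :: w)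

/-- The `n`-th generation: the words `(i_1, …, i_n)` with
`1 ≤ i_k ≤ N_{(i_1, …, i_{k-1})}` for every `k`. -/
def generation (S : J → WeightedIFS a b) : (List ℕ → J) → ℕ → Finset (List ℕ)
  | _, 0 => {[]}
  | I, n + 1 => (Finset.Icc 1 (S (I [])).N).biUnion fun i =>
      (generation S (subtree I i) n).image fun w => i :: w

/-- `m_{(i_1, …, i_n)} = m_{i_1}^{(∅)} m_{i_2}^{((i_1))} ⋯ m_{i_n}^{((i_1, …, i_{n-1}))}`. -/
def wordMass (S : J → WeightedIFS a b) : (List ℕ → J) → List ℕ → ℝ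
  | _, [] => 1
  | I, i :: w => (S (I [])).m i * wordMass S (subtree I i) w

/-- `S_{(i_1, …, i_n)} = S_{i_1}^{(∅)} ∘ S_{i_2}^{((i_1))} ∘ ⋯ ∘ S_{i_n}^{((i_1, …, i_{n-1}))}`. -/
def wordMap (S : J → WeightedIFS a b) : (List ℕ → J) → List ℕ → ℝ → ℝ
  | _, [] => id
  | I, i :: w => (S (I [])).map i ∘ wordMap S (subtree I i) w

/-- `μ_0`, the Lebesgue measure on `[a, b]` divided by `b - a`. -/
def baseMeasure (a b : ℝ) : Measure ℝ :=
  ENNReal.ofReal (1 / (b - a)) • volume.restrict (Set.Icc a b)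

instance (a b : ℝ) : IsFiniteMeasure (baseMeasure a b) := by
  unfold baseMeasure
  exact Measure.smul_finite _ ENNReal.ofReal_ne_top

/-- `μ_n^{(I)} = ∑_{w ∈ I_n} m_w μ_0 ∘ S_w⁻¹`. -/
def levelMeasure (S : J → WeightedIFS a b) (I : List ℕ → J) (n : ℕ) : FiniteMeasure ℝ :=
  ⟨∑ w ∈ generation S I n,
      ENNReal.ofReal (wordMass S I w) • (baseMeasure a b).map (wordMap S I w), by
    have h : ∀ w ∈ generation S I n, IsFiniteMeasure
        (ENNReal.ofReal (wordMass S I w) • (baseMeasure a b).map (wordMap S I w)) :=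
      fun w _ => Measure.smul_finite _ ENNReal.ofReal_ne_top
    constructor
    rw [Measure.finsetSum_apply]
    exact ENNReal.sum_lt_top.2 fun w hw => (h w hw).measure_univ_lt_top⟩

/-- The recursive Cantor measure `μ^{(I)}`: the limit of `μ_n^{(I)}` in the topology of weak
convergence of finite measures. -/
def cantorMeasure (S : J → WeightedIFS a b) (I : List ℕ → J) : FiniteMeasure ℝ :=
  limUnder atTop (levelMeasure S I)

end Tree

section Form

/-- The Sobolev space `H¹` of `[a, b]`. An element is a continuous function `f` on `[a, b]` along
with its weak derivative `f' ∈ L²` (Lebesgue measure), that is, `f y - f x = ∫_x^y f'` for all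
`x, y`. The class of `f'` is determined by `f`. -/
def H1 (a b : ℝ) :
    Submodule ℝ (C(Set.Icc a b, ℝ) × Lp ℝ 2 (volume.restrict (Set.Icc a b))) where
  carrier := {f | ∀ x y : Set.Icc a b, f.1 y - f.1 x = ∫ t in (x : ℝ)..y, f.2 t}
  zero_mem' := by
    intro x y
    have h : (0 : ℝ) = ∫ t in (x : ℝ)..y,
        (0 : Lp ℝ 2 (volume.restrict (Set.Icc a b))) t := by
      have h0 := Lp.coeFn_zero ℝ 2 (volume.restrict (Set.Icc a b))
      rw [Filter.EventuallyEq, ae_restrict_iff' measurableSet_Icc] at h0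
      rw [intervalIntegral.integral_congr_ae (g := fun _ => (0 : ℝ))]
      · simp
      · filter_upwards [h0] with t ht hm
        have := Set.uIoc_subset_uIcc hm
        exact ht ((Set.uIcc_subset_Icc x.2 y.2) this)
    simpa using h
  add_mem' := by
    intro f g hf hg x y
    have hint : ∀ u : Lp ℝ 2 (volume.restrict (Set.Icc a b)),
        IntervalIntegrable u volume x y := by
      intro u
      have h1 : IntegrableOn u (Set.Icc a b) volume := (Lp.memLp u).integrable (by norm_num)
      rw [intervalIntegrable_iff]
      exact h1.mono_set (Set.uIoc_subset_uIcc.trans (Set.uIcc_subset_Icc x.2 y.2))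
    have h0 := Lp.coeFn_add f.2 g.2
    rw [Filter.EventuallyEq, ae_restrict_iff' measurableSet_Icc] at h0
    have h : ∫ t in (x : ℝ)..y, (f.2 + g.2) t = ∫ t in (x : ℝ)..y, (f.2 t + g.2 t) := by
      apply intervalIntegral.integral_congr_ae
      filter_upwards [h0] with t ht hm
      exact ht ((Set.uIcc_subset_Icc x.2 y.2) (Set.uIoc_subset_uIcc hm))
    have e : (f + g).2 = f.2 + g.2 := rfl
    rw [e, h, intervalIntegral.integral_add (hint _) (hint _), ← hf x y, ← hg x y]
    simp only [Prod.fst_add, ContinuousMap.add_apply]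
    ring
  smul_mem' := by
    intro k f hf x y
    have h0 := Lp.coeFn_smul k f.2
    rw [Filter.EventuallyEq, ae_restrict_iff' measurableSet_Icc] at h0
    have h : ∫ t in (x : ℝ)..y, (k • f.2) t = ∫ t in (x : ℝ)..y, k * f.2 t := by
      apply intervalIntegral.integral_congr_ae
      filter_upwards [h0] with t ht hm
      exact ht ((Set.uIcc_subset_Icc x.2 y.2) (Set.uIoc_subset_uIcc hm))
    have e : (k • f).2 = k • f.2 := rfl
    rw [e, h, intervalIntegral.integral_const_mul, ← hf x y]
    simp only [Prod.smul_fst, ContinuousMap.smul_apply, smul_eq_mul]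
    ring

/-- The elements of `H¹` that vanish at `a` and at `b`. -/
def H1Zero (a b : ℝ) :
    Submodule ℝ (C(Set.Icc a b, ℝ) × Lp ℝ 2 (volume.restrict (Set.Icc a b))) where
  carrier := {f | f ∈ H1 a b ∧ ∀ x : Set.Icc a b, (x : ℝ) = a ∨ (x : ℝ) = b → f.1 x = 0}
  zero_mem' := ⟨zero_mem _, fun _ _ => rfl⟩
  add_mem' := by
    intro f g hf hg
    exact ⟨add_mem hf.1 hg.1, fun x hx => by simp [hf.2 x hx, hg.2 x hx]⟩
  smul_mem' := by
    intro k f hf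
    exact ⟨Submodule.smul_mem _ k hf.1, fun x hx => by simp [hf.2 x hx]⟩

variable {a b : ℝ}

/-- The form `𝓔(f, g) = ∫_a^b f' g' dx`. -/
def energy (f g : C(Set.Icc a b, ℝ) × Lp ℝ 2 (volume.restrict (Set.Icc a b))) : ℝ :=
  ∫ t in Set.Icc a b, f.2 t * g.2 t

/-- The inner product `∫_{[a,b]} f g dμ` of `L²(μ)`. -/
def innerMu (μ : FiniteMeasure ℝ)
    (f g : C(Set.Icc a b, ℝ) × Lp ℝ 2 (volume.restrict (Set.Icc a b))) : ℝ :=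
  ∫ x : Set.Icc a b, f.1 x * g.1 x ∂((μ : Measure ℝ).comap Subtype.val)

theorem energy_eq_inner (f g : C(Set.Icc a b, ℝ) × Lp ℝ 2 (volume.restrict (Set.Icc a b))) :
    energy f g = inner ℝ f.2 g.2 := by
  rw [L2.inner_def]
  unfold energy
  congr 1
  ext t
  simp [mul_comm]

theorem innerMu_integrable (μ : FiniteMeasure ℝ)
    (f g : C(Set.Icc a b, ℝ) × Lp ℝ 2 (volume.restrict (Set.Icc a b))) :
    Integrable (fun x : Set.Icc a b => f.1 x * g.1 x)
      ((μ : Measure ℝ).comap Subtype.val) := by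
  have : IsFiniteMeasure ((μ : Measure ℝ).comap (Subtype.val : Set.Icc a b → ℝ)) := by
    constructor
    rw [(MeasurableEmbedding.subtype_coe measurableSet_Icc).comap_apply]
    exact measure_lt_top _ _
  exact (f.1 * g.1).continuous.integrable_of_hasCompactSupport
    (HasCompactSupport.of_compactSpace _)

/-- The eigenspace of the form `𝓔` with domain `V` on `L²(μ)` for the number `l`: all `f ∈ V` with
`𝓔(f, g) = l ⟨f, g⟩_{L²(μ)}` for every `g ∈ V`. -/
def eigenspace (V : Submodule ℝ (C(Set.Icc a b, ℝ) × Lp ℝ 2 (volume.restrict (Set.Icc a b))))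
    (μ : FiniteMeasure ℝ) (l : ℝ) :
    Submodule ℝ (C(Set.Icc a b, ℝ) × Lp ℝ 2 (volume.restrict (Set.Icc a b))) where
  carrier := {f | f ∈ V ∧ ∀ g ∈ V, energy f g = l * innerMu μ f g}
  zero_mem' := ⟨zero_mem _, fun g _ => by simp [energy_eq_inner, innerMu]⟩
  add_mem' := by
    intro f h hf hh
    refine ⟨add_mem hf.1 hh.1, fun g hg => ?_⟩
    have e : innerMu μ (f + h) g = innerMu μ f g + innerMu μ h g := by
      unfold innerMu
      rw [← integral_add (innerMu_integrable μ f g) (innerMu_integrable μ h g)]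
      simp [add_mul]
    rw [e, mul_add, ← hf.2 g hg, ← hh.2 g hg]
    simp [energy_eq_inner, inner_add_left]
  smul_mem' := by
    intro k f hf
    refine ⟨Submodule.smul_mem _ k hf.1, fun g hg => ?_⟩
    have e : innerMu μ (k • f) g = k * innerMu μ f g := by
      unfold innerMu
      rw [← integral_const_mul]
      simp [mul_assoc]
    rw [e, mul_left_comm, ← hf.2 g hg]
    simp [energy_eq_inner, real_inner_smul_left]

/-- The number of eigenvalues `≤ x`, counted with multiplicity: each real `l ≤ x` contributes one
pair `(l, k)` for every natural number `k` below the dimension of its eigenspace. -/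
def eigenvalueCount
    (V : Submodule ℝ (C(Set.Icc a b, ℝ) × Lp ℝ 2 (volume.restrict (Set.Icc a b))))
    (μ : FiniteMeasure ℝ) (x : ℝ) : ℕ∞ :=
  {p : ℝ × ℕ | p.1 ≤ x ∧ (p.2 : Cardinal) < Module.rank ℝ (eigenspace V μ p.1)}.encard

variable {J : Type*}

/-- The Dirichlet eigenvalue counting function `N_D^{(I)}`. -/
def countD (S : J → WeightedIFS a b) (I : List ℕ → J) (x : ℝ) : ℕ∞ :=
  eigenvalueCount (H1Zero a b) (cantorMeasure S I) x

/-- The Neumann eigenvalue counting function `N_N^{(I)}`. -/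
def countN (S : J → WeightedIFS a b) (I : List ℕ → J) (x : ℝ) : ℕ∞ :=
  eigenvalueCount (H1 a b) (cantorMeasure S I) x

end Form

end RecursiveCantor

end

namespace RecursiveCantor

theorem map_affine_volume {ρ : ℝ} (hρ : 0 < ρ) (γ : ℝ) :
    Measure.map (fun x => ρ * x + γ) volume = ENNReal.ofReal ρ⁻¹ • (volume : Measure ℝ) := by
  have h : (fun x => ρ * x + γ) = (fun x => x + γ) ∘ (fun x => ρ * x) := rfl
  rw [h, ← Measure.map_map (by fun_prop) (by fun_prop), Real.map_volume_mul_left hρ.ne',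
    Measure.map_smul, map_add_right_eq_self, abs_of_pos (inv_pos.2 hρ)]

theorem setLIntegral_comp_affine {ρ : ℝ} (hρ : 0 < ρ) (γ : ℝ) {s : Set ℝ} (hs : MeasurableSet s)
    {f : ℝ → ENNReal} (hf : Measurable f) :
    ∫⁻ x in (fun x => ρ * x + γ) ⁻¹' s, f (ρ * x + γ) = ENNReal.ofReal ρ⁻¹ * ∫⁻ x in s, f x := by
  rw [← lintegral_map (f := f) (g := fun x => ρ * x + γ) hf (by fun_prop),
    ← Measure.restrict_map (by fun_prop) hs, map_affine_volume hρ, Measure.restrict_smul,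
    lintegral_smul_measure, smul_eq_mul]

namespace WeightedIFS

variable {a b : ℝ} (s : WeightedIFS a b)

theorem measurable_map (i : ℕ) : Measurable (s.map i) := by
  unfold map; fun_prop

theorem continuous_map (i : ℕ) : Continuous (s.map i) := by
  unfold map; fun_prop

theorem r_pos {i : ℕ} (hi : i ∈ Finset.Icc 1 s.N) : 0 < s.r i := (s.r_mem i hi).1

theorem map_mono {i : ℕ} (hi : i ∈ Finset.Icc 1 s.N) : Monotone (s.map i) := fun x y h => by
  have := mul_le_mul_of_nonneg_left h (s.r_pos hi).le
  unfold map; linarith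

theorem map_right_le_map_left (hab : a < b) {i j : ℕ} (hi : i ∈ Finset.Icc 1 s.N)
    (hj : j ∈ Finset.Icc 1 s.N) (hij : i < j) : s.map i b ≤ s.map j a := by
  rw [Finset.mem_Icc] at hi hj
  induction j, hij using Nat.le_induction with
  | base => exact s.ordered i hi.1 (by omega)
  | succ k hk ih =>
    have h1 := ih ⟨by omega, by omega⟩
    have h2 := s.map_mono (i := k) (Finset.mem_Icc.2 ⟨by omega, by omega⟩) hab.le
    have h3 : s.map k b ≤ s.map (k + 1) a := s.ordered k (by omega) (by omega)
    linarith

theorem one_mem : 1 ∈ Finset.Icc 1 s.N := Finset.mem_Icc.2 ⟨le_rfl, by have := s.two_le_N; omega⟩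

theorem N_mem : s.N ∈ Finset.Icc 1 s.N := Finset.mem_Icc.2 ⟨by have := s.two_le_N; omega, le_rfl⟩

theorem map_mem_Icc (hab : a < b) {i : ℕ} (hi : i ∈ Finset.Icc 1 s.N) {x : ℝ}
    (hx : x ∈ Set.Icc a b) : s.map i x ∈ Set.Icc a b := by
  have hl : a ≤ s.map i a := by
    rcases (Finset.mem_Icc.1 hi).1.eq_or_lt with rfl | h
    · exact s.first_left.ge
    · have h1 := s.map_right_le_map_left hab s.one_mem hi h
      have h2 := s.map_mono s.one_mem hab.le
      have h3 : s.map 1 a = a := s.first_left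
      linarith
  have hr : s.map i b ≤ b := by
    rcases (Finset.mem_Icc.1 hi).2.eq_or_lt with h | h
    · subst h; exact s.last_right.le
    · have h1 := s.map_right_le_map_left hab hi s.N_mem h
      have h2 := s.map_mono s.N_mem hab.le
      have h3 : s.map s.N b = b := s.last_right
      linarith
  exact ⟨hl.trans (s.map_mono hi hx.1), (s.map_mono hi hx.2).trans hr⟩

/-- The total weight of the maps to the left of the `i`-th one. -/
noncomputable def cumMass (i : ℕ) : ℝ := ∑ k ∈ Finset.Ico 1 i, s.m k

theorem cumMass_succ {i : ℕ} (hi : 1 ≤ i) : s.cumMass (i + 1) = s.cumMass i + s.m i :=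
  Finset.sum_Ico_succ_top hi _

theorem cumMass_one : s.cumMass 1 = 0 := by simp [cumMass]

theorem cumMass_last : s.cumMass (s.N + 1) = 1 := s.m_sum

theorem cumMass_le {i j : ℕ} (hij : i ≤ j) (hj : j ≤ s.N + 1) : s.cumMass i ≤ s.cumMass j := by
  refine Finset.sum_le_sum_of_subset_of_nonneg (Finset.Ico_subset_Ico le_rfl hij) fun k hk _ => ?_
  rw [Finset.mem_Ico] at hk
  exact (s.m_pos k (Finset.mem_Icc.2 ⟨hk.1, by omega⟩)).le

/-- The parameters in `[0, 1)` belonging to the `i`-th map. -/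
def cell (i : ℕ) : Set ℝ := Set.Ico (s.cumMass i) (s.cumMass (i + 1))

theorem measurableSet_cell (i : ℕ) : MeasurableSet (s.cell i) := measurableSet_Ico

theorem disjoint_cell {i j : ℕ} (hi : i ∈ Finset.Icc 1 s.N) (hj : j ∈ Finset.Icc 1 s.N)
    (hij : i ≠ j) : Disjoint (s.cell i) (s.cell j) := by
  wlog h : i < j generalizing i j
  · exact (this hj hi hij.symm (by omega)).symm
  rw [Set.disjoint_left]
  intro x hx hy
  have := s.cumMass_le (i := i + 1) (j := j) h (by rw [Finset.mem_Icc] at hj; omega)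
  exact absurd (hx.2.trans_le this) (not_lt.2 hy.1)

theorem exists_mem_cell {u : ℝ} (hu : u ∈ Set.Ico (0 : ℝ) 1) :
    ∃ i ∈ Finset.Icc 1 s.N, u ∈ s.cell i := by
  have : ∀ n ≤ s.N, u < s.cumMass (n + 1) → ∃ i ∈ Finset.Icc 1 s.N, u ∈ s.cell i := by
    intro n
    induction n with
    | zero => intro _ h; rw [zero_add, s.cumMass_one] at h; exact absurd hu.1 (not_le.2 h)
    | succ n ih =>
      intro hn h
      by_cases h' : u < s.cumMass (n + 1)
      · exact ih (by omega) h'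
      · exact ⟨n + 1, Finset.mem_Icc.2 ⟨by omega, hn⟩, not_lt.1 h', h⟩
  exact this s.N le_rfl (s.cumMass_last.symm ▸ hu.2)

theorem iUnion_cell : ⋃ i ∈ Finset.Icc 1 s.N, s.cell i = Set.Ico (0 : ℝ) 1 := by
  ext u
  simp only [Set.mem_iUnion]
  constructor
  · rintro ⟨i, hi, hu⟩
    rw [Finset.mem_Icc] at hi
    have h0 := s.cumMass_le hi.1 (by omega)
    have h1 := s.cumMass_le (i := i + 1) (by omega) le_rfl
    rw [s.cumMass_one] at h0
    rw [s.cumMass_last] at h1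
    exact ⟨h0.trans hu.1, hu.2.trans_le h1⟩
  · intro hu
    obtain ⟨i, hi, h⟩ := s.exists_mem_cell hu
    exact ⟨i, hi, h⟩

/-- The increasing affine bijection of the `i`-th cell onto `[0, 1)`. -/
noncomputable def rescale (i : ℕ) (u : ℝ) : ℝ := (s.m i)⁻¹ * u + -((s.m i)⁻¹ * s.cumMass i)

theorem preimage_rescale {i : ℕ} (hi : i ∈ Finset.Icc 1 s.N) :
    s.rescale i ⁻¹' Set.Ico 0 1 = s.cell i := by
  have hm := s.m_pos i hi
  ext u
  have e : s.rescale i u = (u - s.cumMass i) / s.m i := by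
    unfold rescale; field_simp; ring
  rw [Set.mem_preimage, e, cell, s.cumMass_succ (Finset.mem_Icc.1 hi).1, Set.mem_Ico, Set.mem_Ico,
    le_div_iff₀ hm, div_lt_iff₀ hm]
  constructor <;> rintro ⟨h1, h2⟩ <;> constructor <;> linarith

end WeightedIFS

section Limit

variable {a b : ℝ} {J : Type*} (S : J → WeightedIFS a b)

/-- The position, in the `n`-th generation, of the particle with parameters `(u, v)`: the number
`u` selects the line of descent according to the weights, and `v` is the relative position within
the interval of the individual that is reached. -/
noncomputable def position : (List ℕ → J) → ℕ → ℝ × ℝ → ℝ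
  | _, 0, p => (b - a) * p.2 + a
  | I, n + 1, p => ∑ i ∈ Finset.Icc 1 (S (I [])).N,
      Set.indicator ((S (I [])).cell i)
        (fun u => (S (I [])).map i (position (subtree I i) n ((S (I [])).rescale i u, p.2))) p.1

theorem position_succ {I : List ℕ → J} {i : ℕ} (hi : i ∈ Finset.Icc 1 (S (I [])).N) {u : ℝ}
    (hu : u ∈ (S (I [])).cell i) (n : ℕ) (v : ℝ) :
    position S I (n + 1) (u, v)
      = (S (I [])).map i (position S (subtree I i) n ((S (I [])).rescale i u, v)) := by
  rw [position, Finset.sum_eq_single_of_mem i hi]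
  · rw [Set.indicator_of_mem hu]
  · intro j hj hji
    exact Set.indicator_of_notMem
      (fun h => Set.disjoint_left.1 ((S (I [])).disjoint_cell hj hi hji) h hu) _

theorem measurable_position (n : ℕ) (I : List ℕ → J) : Measurable (position S I n) := by
  induction n generalizing I with
  | zero => exact ((measurable_snd.const_mul (b - a)).add_const a)
  | succ n ih =>
    have : position S I (n + 1) = fun p => ∑ i ∈ Finset.Icc 1 (S (I [])).N,
        Set.indicator (Prod.fst ⁻¹' (S (I [])).cell i) (fun p : ℝ × ℝ => (S (I [])).map i
          (position S (subtree I i) n ((S (I [])).rescale i p.1, p.2))) p := by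
      ext p
      rw [position]
      rfl
    rw [this]
    refine Finset.measurable_sum _ fun i _ => Measurable.indicator ?_
      (measurable_fst ((S (I [])).measurableSet_cell i))
    refine ((S (I [])).measurable_map i).comp ((ih (subtree I i)).comp ?_)
    unfold WeightedIFS.rescale
    fun_prop

/-- The law of the parameters. -/
noncomputable def paramMeasure : Measure (ℝ × ℝ) :=
  (volume.restrict (Set.Ico (0 : ℝ) 1)).prod (volume.restrict (Set.Icc (0 : ℝ) 1))

instance : IsProbabilityMeasure paramMeasure := by
  have h1 : IsProbabilityMeasure (volume.restrict (Set.Ico (0 : ℝ) 1)) := ⟨by simp⟩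
  have h2 : IsProbabilityMeasure (volume.restrict (Set.Icc (0 : ℝ) 1)) := ⟨by simp⟩
  unfold paramMeasure
  infer_instance

theorem ae_paramMeasure : ∀ᵐ p ∂paramMeasure, p.1 ∈ Set.Ico (0 : ℝ) 1 ∧ p.2 ∈ Set.Icc (0 : ℝ) 1 := by
  unfold paramMeasure
  rw [Measure.prod_restrict]
  exact ae_restrict_mem (measurableSet_Ico.prod measurableSet_Icc)

theorem position_mem_Icc (hab : a < b) {u v : ℝ} (hu : u ∈ Set.Ico (0 : ℝ) 1)
    (hv : v ∈ Set.Icc (0 : ℝ) 1) (n : ℕ) (I : List ℕ → J) :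
    position S I n (u, v) ∈ Set.Icc a b := by
  induction n generalizing I u with
  | zero =>
    unfold position
    constructor <;> nlinarith [hv.1, hv.2]
  | succ n ih =>
    obtain ⟨i, hi, hu'⟩ := (S (I [])).exists_mem_cell hu
    rw [position_succ S hi hu']
    rw [← (S (I [])).preimage_rescale hi] at hu'
    exact (S (I [])).map_mem_Icc hab hi (ih hu' (subtree I i))

theorem position_affine {u : ℝ} (hu : u ∈ Set.Ico (0 : ℝ) 1) (v : ℝ) (n : ℕ) (I : List ℕ → J) :
    position S I n (u, v) = (1 - v) * position S I n (u, 0) + v * position S I n (u, 1) := by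
  induction n generalizing I u with
  | zero => unfold position; ring
  | succ n ih =>
    obtain ⟨i, hi, hu'⟩ := (S (I [])).exists_mem_cell hu
    simp only [position_succ S hi hu']
    rw [← (S (I [])).preimage_rescale hi] at hu'
    rw [ih hu' (subtree I i)]
    unfold WeightedIFS.map
    ring

theorem position_zero_mono (hab : a < b) {u : ℝ} (hu : u ∈ Set.Ico (0 : ℝ) 1) (n : ℕ)
    (I : List ℕ → J) : position S I n (u, 0) ≤ position S I (n + 1) (u, 0) := by
  induction n generalizing I u with
  | zero =>
    have := (position_mem_Icc S hab hu (v := 0) (by simp) 1 I).1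
    rw [position]
    simpa using this
  | succ n ih =>
    obtain ⟨i, hi, hu'⟩ := (S (I [])).exists_mem_cell hu
    rw [position_succ S hi hu', position_succ S hi hu']
    rw [← (S (I [])).preimage_rescale hi] at hu'
    exact (S (I [])).map_mono hi (ih hu' (subtree I i))

theorem position_one_anti (hab : a < b) {u : ℝ} (hu : u ∈ Set.Ico (0 : ℝ) 1) (n : ℕ)
    (I : List ℕ → J) : position S I (n + 1) (u, 1) ≤ position S I n (u, 1) := by
  induction n generalizing I u with
  | zero =>
    have := (position_mem_Icc S hab hu (v := 1) (by simp) 1 I).2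
    rw [position.eq_1]
    simpa using this
  | succ n ih =>
    obtain ⟨i, hi, hu'⟩ := (S (I [])).exists_mem_cell hu
    rw [position_succ S hi hu', position_succ S hi hu']
    rw [← (S (I [])).preimage_rescale hi] at hu'
    exact (S (I [])).map_mono hi (ih hu' (subtree I i))

theorem exists_tendsto_position (hab : a < b) {u : ℝ} (hu : u ∈ Set.Ico (0 : ℝ) 1) (v : ℝ)
    (I : List ℕ → J) : ∃ l, Tendsto (fun n => position S I n (u, v)) atTop (𝓝 l) := by
  have h0 := tendsto_atTop_ciSup
    (monotone_nat_of_le_succ fun n => position_zero_mono S hab hu n I)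
    ⟨b, by rintro _ ⟨n, rfl⟩; exact (position_mem_Icc S hab hu (v := 0) (by simp) n I).2⟩
  have h1 := tendsto_atTop_ciInf
    (antitone_nat_of_succ_le fun n => position_one_anti S hab hu n I)
    ⟨a, by rintro _ ⟨n, rfl⟩; exact (position_mem_Icc S hab hu (v := 1) (by simp) n I).1⟩
  refine ⟨_, ((h0.const_mul (1 - v)).add (h1.const_mul v)).congr fun n => ?_⟩
  exact (position_affine S hu v n I).symm

theorem lintegral_position_succ (n : ℕ) (I : List ℕ → J) {f : ℝ → ENNReal} (hf : Measurable f) :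
    ∫⁻ p, f (position S I (n + 1) p) ∂paramMeasure
      = ∑ i ∈ Finset.Icc 1 (S (I [])).N, ENNReal.ofReal ((S (I [])).m i) *
          ∫⁻ p, f ((S (I [])).map i (position S (subtree I i) n p)) ∂paramMeasure := by
  have hmeas : ∀ i, Measurable fun p => f ((S (I [])).map i (position S (subtree I i) n p)) :=
    fun i => hf.comp (((S (I [])).measurable_map i).comp (measurable_position S n _))
  unfold paramMeasure
  have hmeas' : Measurable fun p => f (position S I (n + 1) p) :=
    hf.comp (measurable_position S (n + 1) I)
  rw [lintegral_prod_symm' _ hmeas']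
  have key : ∀ v, ∫⁻ u in Set.Ico (0 : ℝ) 1, f (position S I (n + 1) (u, v))
      = ∑ i ∈ Finset.Icc 1 (S (I [])).N, ENNReal.ofReal ((S (I [])).m i) *
        ∫⁻ u in Set.Ico (0 : ℝ) 1, f ((S (I [])).map i (position S (subtree I i) n (u, v))) := by
    intro v
    rw [← (S (I [])).iUnion_cell, lintegral_biUnion_finset
      (fun i hi j hj hij => (S (I [])).disjoint_cell hi hj hij)
      (fun i _ => (S (I [])).measurableSet_cell i)]
    refine Finset.sum_congr rfl fun i hi => ?_
    rw [setLIntegral_congr_fun ((S (I [])).measurableSet_cell i)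
      (g := fun u => f ((S (I [])).map i
        (position S (subtree I i) n ((S (I [])).rescale i u, v))))
      (fun u hu => by simp only [position_succ S hi hu])]
    rw [(S (I [])).iUnion_cell, ← (S (I [])).preimage_rescale hi]
    have := setLIntegral_comp_affine (inv_pos.2 ((S (I [])).m_pos i hi))
      (-(((S (I [])).m i)⁻¹ * (S (I [])).cumMass i)) (measurableSet_Ico (a := (0 : ℝ)) (b := 1))
      (f := fun u => f ((S (I [])).map i (position S (subtree I i) n (u, v))))
      ((hmeas i).comp (by fun_prop))
    rw [inv_inv] at this
    exact this
  simp only [key]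
  rw [lintegral_finsetSum]
  · refine Finset.sum_congr rfl fun i hi => ?_
    rw [lintegral_const_mul, lintegral_prod_symm' _ (hmeas i)]
    exact (hmeas i).lintegral_prod_left'
  · intro i hi
    exact ((hmeas i).lintegral_prod_left').const_mul _

theorem measurable_wordMap (w : List ℕ) (I : List ℕ → J) : Measurable (wordMap S I w) := by
  induction w generalizing I with
  | nil => exact measurable_id
  | cons i w ih => exact ((S (I [])).measurable_map i).comp (ih _)

theorem levelMeasure_succ (n : ℕ) (I : List ℕ → J) :
    (levelMeasure S I (n + 1) : Measure ℝ)
      = ∑ i ∈ Finset.Icc 1 (S (I [])).N, ENNReal.ofReal ((S (I [])).m i) •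
          (levelMeasure S (subtree I i) n : Measure ℝ).map ((S (I [])).map i) := by
  simp only [levelMeasure, FiniteMeasure.toMeasure_mk, generation]
  rw [Finset.sum_biUnion]
  · refine Finset.sum_congr rfl fun i hi => ?_
    rw [Finset.sum_image (fun w _ w' _ h => (List.cons.inj h).2), Measure.map_finset_sum
      (((S (I [])).measurable_map i).aemeasurable), Finset.smul_sum]
    refine Finset.sum_congr rfl fun w _ => ?_
    rw [Measure.map_smul, smul_smul, Measure.map_map ((S (I [])).measurable_map i)
      (measurable_wordMap S w _), wordMass, wordMap, ENNReal.ofReal_mul ((S (I [])).m_pos i hi).le]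
  · intro i _ j _ hij
    simp only [Function.onFun, Finset.disjoint_left, Finset.mem_image, not_exists, not_and]
    rintro _ ⟨w, _, rfl⟩ w' _ h
    exact hij (List.cons.inj h).1.symm

theorem levelMeasure_eq_map (hab : a < b) (n : ℕ) (I : List ℕ → J) :
    (levelMeasure S I n : Measure ℝ) = paramMeasure.map (position S I n) := by
  induction n generalizing I with
  | zero =>
    refine Measure.ext_of_lintegral _ fun f hf => ?_
    rw [lintegral_map hf (measurable_position S 0 I)]
    unfold paramMeasure
    have hmeas : Measurable fun p => f (position S I 0 p) := hf.comp (measurable_position S 0 I)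
    rw [lintegral_prod_symm' _ hmeas]
    have h := setLIntegral_comp_affine (sub_pos.2 hab) a (measurableSet_Icc (a := a) (b := b)) hf
    have e : (fun x => (b - a) * x + a) ⁻¹' Set.Icc a b = Set.Icc 0 1 := by
      ext x
      have := sub_pos.2 hab
      simp only [Set.mem_preimage, Set.mem_Icc]
      constructor <;> rintro ⟨h1, h2⟩ <;> constructor <;> nlinarith
    rw [e] at h
    simp [levelMeasure, generation, wordMass, wordMap, baseMeasure, position, h]
  | succ n ih =>
    refine Measure.ext_of_lintegral _ fun f hf => ?_
    rw [levelMeasure_succ, lintegral_map hf (measurable_position S _ I),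
      lintegral_position_succ S n I hf, lintegral_finsetSum_measure]
    refine Finset.sum_congr rfl fun i _ => ?_
    have hmeas : Measurable fun x => f ((S (I [])).map i x) :=
      hf.comp ((S (I [])).measurable_map i)
    rw [lintegral_smul_measure, smul_eq_mul, lintegral_map hf ((S (I [])).measurable_map i), ih,
      lintegral_map hmeas (measurable_position S _ _)]

theorem exists_limit_position (hab : a < b) (I : List ℕ → J) :
    ∃ X : ℝ × ℝ → ℝ, Measurable X ∧
      ∀ᵐ p ∂paramMeasure, Tendsto (fun n => position S I n p) atTop (𝓝 (X p)) := by
  refine measurable_limit_of_tendsto_metrizable_ae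
    (fun n => (measurable_position S n I).aemeasurable) ?_
  filter_upwards [ae_paramMeasure] with p hp
  exact exists_tendsto_position S hab hp.1 p.2 I

theorem exists_cantorMeasure_eq_map (hab : a < b) (I : List ℕ → J) :
    ∃ X : ℝ × ℝ → ℝ, Measurable X ∧ (∀ᵐ p ∂paramMeasure, X p ∈ Set.Icc a b) ∧
      (cantorMeasure S I : Measure ℝ) = paramMeasure.map X ∧
      Tendsto (levelMeasure S I) atTop (𝓝 (cantorMeasure S I)) := by
  obtain ⟨X, hX, hlim⟩ := exists_limit_position S hab I
  have : IsProbabilityMeasure (paramMeasure.map X) :=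
    Measure.isProbabilityMeasure_map hX.aemeasurable
  obtain ⟨ν, hν⟩ : ∃ ν : FiniteMeasure ℝ, (ν : Measure ℝ) = paramMeasure.map X :=
    ⟨⟨paramMeasure.map X, inferInstance⟩, rfl⟩
  have ht : Tendsto (levelMeasure S I) atTop (𝓝 ν) := by
    rw [FiniteMeasure.tendsto_iff_forall_integral_tendsto]
    intro f
    rw [hν, integral_map hX.aemeasurable f.continuous.aestronglyMeasurable]
    simp only [levelMeasure_eq_map S hab]
    simp_rw [integral_map (measurable_position S _ I).aemeasurable
      f.continuous.aestronglyMeasurable]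
    refine tendsto_integral_of_dominated_convergence (fun _ => ‖f‖)
      (fun n => (f.continuous.measurable.comp (measurable_position S n I)).aestronglyMeasurable)
      (integrable_const _) (fun n => Eventually.of_forall fun p => f.norm_coe_le_norm _) ?_
    filter_upwards [hlim] with p hp
    exact (f.continuous.tendsto _).comp hp
  refine ⟨X, hX, ?_, ?_, ?_⟩
  · filter_upwards [hlim, ae_paramMeasure] with p hp hp'
    exact isClosed_Icc.mem_of_tendsto hp
      (Eventually.of_forall fun n => position_mem_Icc S hab hp'.1 hp'.2 n I)
  · rw [cantorMeasure, ht.limUnder_eq]; exact hν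
  · rw [cantorMeasure, ht.limUnder_eq]; exact ht

theorem tendsto_levelMeasure (hab : a < b) (I : List ℕ → J) :
    Tendsto (levelMeasure S I) atTop (𝓝 (cantorMeasure S I)) :=
  (exists_cantorMeasure_eq_map S hab I).choose_spec.2.2.2

theorem isProbabilityMeasure_cantorMeasure (hab : a < b) (I : List ℕ → J) :
    IsProbabilityMeasure (cantorMeasure S I : Measure ℝ) := by
  obtain ⟨X, hX, -, h, -⟩ := exists_cantorMeasure_eq_map S hab I
  rw [h]
  exact Measure.isProbabilityMeasure_map hX.aemeasurable

theorem cantorMeasure_ae_mem_Icc (hab : a < b) (I : List ℕ → J) :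
    ∀ᵐ x ∂(cantorMeasure S I : Measure ℝ), x ∈ Set.Icc a b := by
  obtain ⟨X, hX, hm, h, -⟩ := exists_cantorMeasure_eq_map S hab I
  rw [h]
  exact (ae_map_iff hX.aemeasurable measurableSet_Icc).2 hm

theorem integral_cantorMeasure (hab : a < b) (I : List ℕ → J) (f : BoundedContinuousFunction ℝ ℝ) :
    ∫ x, f x ∂(cantorMeasure S I : Measure ℝ)
      = ∑ i ∈ Finset.Icc 1 (S (I [])).N, (S (I [])).m i *
          ∫ x, f ((S (I [])).map i x) ∂(cantorMeasure S (subtree I i) : Measure ℝ) := by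
  have h := (FiniteMeasure.tendsto_iff_forall_integral_tendsto.1 (tendsto_levelMeasure S hab I) f).comp
    (tendsto_add_atTop_nat 1)
  refine tendsto_nhds_unique h ?_
  have h' : ∀ n, ∫ x, f x ∂(levelMeasure S I (n + 1) : Measure ℝ)
      = ∑ i ∈ Finset.Icc 1 (S (I [])).N, (S (I [])).m i *
          ∫ x, f ((S (I [])).map i x) ∂(levelMeasure S (subtree I i) n : Measure ℝ) := by
    intro n
    rw [levelMeasure_succ, integral_finsetSum_measure]
    · refine Finset.sum_congr rfl fun i hi => ?_
      rw [integral_smul_measure, integral_map ((S (I [])).measurable_map i).aemeasurable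
        f.continuous.aestronglyMeasurable, ENNReal.toReal_ofReal ((S (I [])).m_pos i hi).le,
        smul_eq_mul]
    · intro i _
      refine Integrable.smul_measure ?_ ENNReal.ofReal_ne_top
      exact f.integrable _
  refine Tendsto.congr (fun n => (h' n).symm) (tendsto_finsetSum _ fun i _ => Tendsto.const_mul _ ?_)
  exact FiniteMeasure.tendsto_iff_forall_integral_tendsto.1
    (tendsto_levelMeasure S hab (subtree I i))
    (f.compContinuous ⟨_, (S (I [])).continuous_map i⟩)

end Limit

end RecursiveCantor

namespace RecursiveCantor

section Forms

variable {a b : ℝ}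

/-- The ambient space of pairs of a continuous function and an `L²` function. -/
abbrev PairSpace (a b : ℝ) : Type :=
  C(Set.Icc a b, ℝ) × Lp ℝ 2 (volume.restrict (Set.Icc a b))

/-- The restriction of a finite measure to `[a, b]`, as a measure on the subtype. -/
noncomputable abbrev restrictIcc (a b : ℝ) (μ : FiniteMeasure ℝ) : Measure (Set.Icc a b) :=
  (μ : Measure ℝ).comap Subtype.val

instance (μ : FiniteMeasure ℝ) : IsFiniteMeasure (restrictIcc a b μ) := by
  constructor
  rw [(MeasurableEmbedding.subtype_coe measurableSet_Icc).comap_apply]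
  exact measure_lt_top _ _

theorem innerMu_eq_inner (μ : FiniteMeasure ℝ) (f g : PairSpace a b) :
    innerMu μ f g = inner ℝ (ContinuousMap.toLp 2 (restrictIcc a b μ) ℝ f.1)
      (ContinuousMap.toLp 2 (restrictIcc a b μ) ℝ g.1) := by
  rw [ContinuousMap.inner_toLp]
  simp [innerMu, mul_comm]

/-- The form `𝓔` as a bilinear form. -/
noncomputable def energyForm (a b : ℝ) : LinearMap.BilinForm ℝ (PairSpace a b) :=
  LinearMap.mk₂ ℝ energy
    (fun f g h => by simp [energy_eq_inner, inner_add_left])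
    (fun c f g => by simp [energy_eq_inner, real_inner_smul_left])
    (fun f g h => by simp [energy_eq_inner, inner_add_right])
    (fun c f g => by simp [energy_eq_inner, real_inner_smul_right])

/-- The inner product of `L²(μ)` as a bilinear form. -/
noncomputable def massForm (μ : FiniteMeasure ℝ) : LinearMap.BilinForm ℝ (PairSpace a b) :=
  LinearMap.mk₂ ℝ (innerMu μ)
    (fun f g h => by simp [innerMu_eq_inner, inner_add_left])
    (fun c f g => by simp [innerMu_eq_inner, real_inner_smul_left])
    (fun f g h => by simp [innerMu_eq_inner, inner_add_right])
    (fun c f g => by simp [innerMu_eq_inner, real_inner_smul_right])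

theorem energyForm_apply (f g : PairSpace a b) : energyForm a b f g = energy f g := rfl

theorem massForm_apply (μ : FiniteMeasure ℝ) (f g : PairSpace a b) :
    massForm μ f g = innerMu μ f g := rfl

theorem energyForm_eq_inner (f g : PairSpace a b) : energyForm a b f g = inner ℝ f.2 g.2 :=
  energy_eq_inner f g

theorem massForm_eq_inner (μ : FiniteMeasure ℝ) (f g : PairSpace a b) :
    massForm μ f g = inner ℝ (ContinuousMap.toLp 2 (restrictIcc a b μ) ℝ f.1)
      (ContinuousMap.toLp 2 (restrictIcc a b μ) ℝ g.1) := innerMu_eq_inner μ f g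

theorem energyForm_comm (f g : PairSpace a b) : energyForm a b f g = energyForm a b g f := by
  simp only [energyForm_eq_inner, real_inner_comm]

theorem massForm_comm (μ : FiniteMeasure ℝ) (f g : PairSpace a b) :
    massForm μ f g = massForm μ g f := by
  simp only [massForm_eq_inner, real_inner_comm]

theorem energyForm_self_nonneg (f : PairSpace a b) : 0 ≤ energyForm a b f f := by
  rw [energyForm_eq_inner]; exact real_inner_self_nonneg

theorem massForm_self_nonneg (μ : FiniteMeasure ℝ) (f : PairSpace a b) : 0 ≤ massForm μ f f := by
  rw [massForm_eq_inner]; exact real_inner_self_nonneg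

theorem continuous_energyForm :
    Continuous fun p : PairSpace a b × PairSpace a b => energyForm a b p.1 p.2 := by
  simp only [energyForm_eq_inner]; fun_prop

theorem continuous_massForm (μ : FiniteMeasure ℝ) :
    Continuous fun p : PairSpace a b × PairSpace a b => massForm μ p.1 p.2 := by
  simp only [massForm_eq_inner]; fun_prop

theorem mem_eigenspace {V : Submodule ℝ (PairSpace a b)} {μ : FiniteMeasure ℝ} {l : ℝ}
    {f : PairSpace a b} : f ∈ eigenspace V μ l ↔
      f ∈ V ∧ ∀ g ∈ V, energyForm a b f g = l * massForm μ f g := Iff.rfl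

theorem massForm_eq_zero_of_mem_eigenspace {V : Submodule ℝ (PairSpace a b)} {μ : FiniteMeasure ℝ}
    {l l' : ℝ} (hl : l ≠ l') {f g : PairSpace a b} (hf : f ∈ eigenspace V μ l)
    (hg : g ∈ eigenspace V μ l') : massForm μ f g = 0 := by
  rw [mem_eigenspace] at hf hg
  have h1 := hf.2 g hg.1
  have h2 := hg.2 f hf.1
  rw [energyForm_comm, h1, massForm_comm μ g f] at h2
  have h3 : (l - l') * massForm μ f g = 0 := by linarith
  exact (mul_eq_zero.1 h3).resolve_left (sub_ne_zero.2 hl)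

/-- The sum of the eigenspaces of eigenvalues `≤ x`. -/
noncomputable def lowSpace (V : Submodule ℝ (PairSpace a b)) (μ : FiniteMeasure ℝ) (x : ℝ) :
    Submodule ℝ (PairSpace a b) :=
  ⨆ l : Set.Iic x, eigenspace V μ l

theorem eigenspace_le_lowSpace (V : Submodule ℝ (PairSpace a b)) (μ : FiniteMeasure ℝ) {l x : ℝ}
    (hl : l ≤ x) : eigenspace V μ l ≤ lowSpace V μ x :=
  le_iSup (fun l : Set.Iic x => eigenspace V μ l) ⟨l, hl⟩

theorem lowSpace_le (V : Submodule ℝ (PairSpace a b)) (μ : FiniteMeasure ℝ) (x : ℝ) :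
    lowSpace V μ x ≤ V :=
  iSup_le fun _ _ h => h.1

theorem energyForm_le_of_mem_lowSpace {V : Submodule ℝ (PairSpace a b)} {μ : FiniteMeasure ℝ}
    {x : ℝ} {f : PairSpace a b} (hf : f ∈ lowSpace V μ x) :
    energyForm a b f f ≤ x * massForm μ f f := by
  obtain ⟨c, hc, rfl⟩ := (Submodule.mem_iSup_iff_exists_finsupp _ _).1 hf
  have hE : energyForm a b (c.sum fun _ y => y) (c.sum fun _ y => y)
      = ∑ l ∈ c.support, l.1 * massForm μ (c l) (c l) := by
    simp only [Finsupp.sum, map_sum, LinearMap.sum_apply]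
    refine Finset.sum_congr rfl fun l hl => ?_
    rw [Finset.sum_eq_single_of_mem l hl]
    · exact (hc l).2 _ (hc l).1
    · intro k _ hk
      have h := (hc k).2 _ (hc l).1
      rw [← energyForm_apply, ← massForm_apply] at h
      rw [h, massForm_eq_zero_of_mem_eigenspace (fun e => hk (Subtype.ext e)) (hc k) (hc l),
        mul_zero]
  have hM : massForm μ (c.sum fun _ y => y) (c.sum fun _ y => y)
      = ∑ l ∈ c.support, massForm μ (c l) (c l) := by
    simp only [Finsupp.sum, map_sum, LinearMap.sum_apply]
    refine Finset.sum_congr rfl fun l hl => ?_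
    rw [Finset.sum_eq_single_of_mem l hl]
    intro k _ hk
    exact massForm_eq_zero_of_mem_eigenspace (fun e => hk (Subtype.ext e)) (hc k) (hc l)
  rw [hE, hM, Finset.mul_sum]
  exact Finset.sum_le_sum fun l _ => mul_le_mul_of_nonneg_right l.2 (massForm_self_nonneg μ _)

theorem mk_nat_lt_le (c : Cardinal.{0}) : Cardinal.mk {k : ℕ // (k : Cardinal) < c} ≤ c := by
  rcases lt_or_ge c Cardinal.aleph0 with h | h
  · obtain ⟨d, rfl⟩ := Cardinal.lt_aleph0.1 h
    simp only [Nat.cast_lt]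
    rw [← Cardinal.mk_congr (Fin.equivSubtype (n := d)), Cardinal.mk_fin]
  · exact (Cardinal.mk_le_aleph0).trans h

theorem exists_linearIndependent_nat (W : Type) [AddCommGroup W] [Module ℝ W] :
    ∃ v : ℕ → W,
      LinearIndependent ℝ (fun k : {k : ℕ // (k : Cardinal) < Module.rank ℝ W} => v k) ∧
      (Module.rank ℝ W < Cardinal.aleph0 → Submodule.span ℝ
        (Set.range fun k : {k : ℕ // (k : Cardinal) < Module.rank ℝ W} => v k) = ⊤) := by
  classical
  obtain ⟨ι, B⟩ := Module.Free.exists_basis (R := ℝ) (M := W)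
  have hB : Cardinal.mk {k : ℕ // (k : Cardinal) < Module.rank ℝ W} ≤ Cardinal.mk ι := by
    rw [B.mk_eq_rank'']
    exact mk_nat_lt_le _
  obtain ⟨e⟩ := Cardinal.le_def _ _ |>.1 hB
  let v : ℕ → W := fun k =>
    if h : (k : Cardinal) < Module.rank ℝ W then B (e ⟨k, h⟩) else 0
  have hv : (fun k : {k : ℕ // (k : Cardinal) < Module.rank ℝ W} => v k) = B ∘ e := by
    ext k
    simp [v, k.2]
  have hli : LinearIndependent ℝ
      (fun k : {k : ℕ // (k : Cardinal) < Module.rank ℝ W} => v k) := by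
    rw [hv]
    exact B.linearIndependent.comp _ e.injective
  refine ⟨v, hli, fun hfin => ?_⟩
  have : FiniteDimensional ℝ W := Module.rank_lt_aleph0_iff.1 hfin
  have e' : {k : ℕ // (k : Cardinal) < Module.rank ℝ W} ≃ Fin (Module.finrank ℝ W) :=
    (Equiv.subtypeEquivRight fun k => by
      rw [← Module.finrank_eq_rank ℝ W, Nat.cast_lt]).trans Fin.equivSubtype.symm
  have : Fintype {k : ℕ // (k : Cardinal) < Module.rank ℝ W} := Fintype.ofEquiv _ e'.symm
  refine hli.span_eq_top_of_card_eq_finrank' ?_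
  rw [Fintype.card_congr e', Fintype.card_fin]

theorem toENat_rank_lowSpace {V : Submodule ℝ (PairSpace a b)} {μ : FiniteMeasure ℝ}
    (hV : ∀ f ∈ V, energyForm a b f f = 0 → massForm μ f f = 0 → f = 0) (x : ℝ) :
    Cardinal.toENat (Module.rank ℝ (lowSpace V μ x)) = eigenvalueCount V μ x := by
  classical
  choose v hv hv' using fun l : ℝ => exists_linearIndependent_nat (eigenspace V μ l)
  set A : Set (ℝ × ℕ) :=
    {p | p.1 ≤ x ∧ (p.2 : Cardinal) < Module.rank ℝ (eigenspace V μ p.1)}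
  let w : A → PairSpace a b := fun p => (v p.1.1 p.1.2 : PairSpace a b)
  have hwl : ∀ p : A, w p ∈ eigenspace V μ p.1.1 := fun p => (v p.1.1 p.1.2).2
  have hw : LinearIndependent ℝ w := by
    rw [linearIndependent_iff']
    intro s c hs p hp
    obtain ⟨l, hl⟩ : ∃ l, p.1.1 = l := ⟨_, rfl⟩
    let f : PairSpace a b := ∑ q ∈ s with q.1.1 = l, c q • w q
    have hf : f ∈ eigenspace V μ l := by
      refine Submodule.sum_mem _ fun q hq => Submodule.smul_mem _ _ ?_
      rw [← (Finset.mem_filter.1 hq).2]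
      exact hwl q
    have hM : massForm μ f f = 0 := by
      have h1 : f + ∑ q ∈ s with ¬ q.1.1 = l, c q • w q = 0 := by
        rw [← hs]
        exact Finset.sum_filter_add_sum_filter_not _ _ _
      have h2 : massForm μ f (∑ q ∈ s with ¬ q.1.1 = l, c q • w q) = 0 := by
        rw [map_sum]
        refine Finset.sum_eq_zero fun q hq => ?_
        rw [map_smul, massForm_eq_zero_of_mem_eigenspace
          (Ne.symm (Finset.mem_filter.1 hq).2) hf (hwl q), smul_zero]
      have h3 : massForm μ f (f + ∑ q ∈ s with ¬ q.1.1 = l, c q • w q) = 0 := by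
        rw [h1, map_zero]
      rwa [map_add, h2, add_zero] at h3
    have hf0 : f = 0 := by
      refine hV f hf.1 ?_ hM
      have := (mem_eigenspace.1 hf).2 f hf.1
      rw [this, hM, mul_zero]
    let φ : {q : A // q.1.1 = l} →
        {k : ℕ // (k : Cardinal) < Module.rank ℝ (eigenspace V μ l)} :=
      fun q => ⟨q.1.1.2, by have := q.1.2.2; rwa [q.2] at this⟩
    have hφ : Function.Injective φ := by
      intro q q' h
      have h1 : q.1.1.2 = q'.1.1.2 := congrArg Subtype.val h
      exact Subtype.ext (Subtype.ext (Prod.ext (q.2.trans q'.2.symm) h1))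
    have hli : LinearIndependent ℝ (fun q : {q : A // q.1.1 = l} => w q.1) := by
      have h1 := ((hv l).comp φ hφ).map' (eigenspace V μ l).subtype (Submodule.ker_subtype _)
      have h2 : (fun q : {q : A // q.1.1 = l} => w q.1)
          = (eigenspace V μ l).subtype ∘ (fun k : {k : ℕ // (k : Cardinal) <
            Module.rank ℝ (eigenspace V μ l)} => v l k) ∘ φ := by
        funext q
        obtain ⟨q, rfl⟩ := q
        rfl
      rw [h2]
      exact h1
    rw [linearIndependent_iff'] at hli
    refine hli (s.subtype fun q => q.1.1 = l) (fun q => c q.1) ?_ ⟨p, hl⟩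
      (Finset.mem_subtype.2 hp)
    rw [← hf0]
    exact (Finset.sum_subtype_eq_sum_filter (f := fun q => c q • w q))
  have hcount : eigenvalueCount V μ x
      = Cardinal.toENat (Module.rank ℝ (Submodule.span ℝ (Set.range w))) := by
    rw [rank_span hw, Cardinal.mk_range_eq _ hw.injective]
    rfl
  have hle : Submodule.span ℝ (Set.range w) ≤ lowSpace V μ x := by
    rw [Submodule.span_le]
    rintro _ ⟨p, rfl⟩
    exact eigenspace_le_lowSpace V μ p.2.1 (hwl p)
  rcases eq_or_ne (eigenvalueCount V μ x) ⊤ with htop | htop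
  · rw [htop, eq_top_iff, ← htop, hcount]
    exact Cardinal.toENat.monotone' (Submodule.rank_mono hle)
  · rw [hcount]
    suffices h : lowSpace V μ x = Submodule.span ℝ (Set.range w) by rw [h]
    refine le_antisymm (iSup_le ?_) hle
    rintro ⟨l, hl⟩
    have hAfin : A.Finite := by
      rw [← Set.encard_ne_top_iff]
      exact htop
    have hr : Module.rank ℝ (eigenspace V μ l) < Cardinal.aleph0 := by
      by_contra hcon
      rw [not_lt] at hcon
      refine Set.infinite_range_of_injective (f := fun k : ℕ => (l, k))
        (fun _ _ h => (Prod.ext_iff.1 h).2) (hAfin.subset ?_)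
      rintro _ ⟨k, rfl⟩
      exact ⟨hl, Cardinal.natCast_lt_aleph0.trans_le hcon⟩
    have h1 := congrArg (Submodule.map (eigenspace V μ l).subtype) (hv' l hr)
    rw [Submodule.map_span, Submodule.map_subtype_top, ← Set.range_comp] at h1
    simp only
    rw [← h1]
    refine Submodule.span_mono ?_
    rintro _ ⟨k, rfl⟩
    exact ⟨⟨(l, k), hl, k.2⟩, rfl⟩

end Forms

end RecursiveCantor

namespace RecursiveCantor

section LinearAlgebra

theorem surjective_of_injective_to_dual {W : Type*} [AddCommGroup W] [Module ℝ W]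
    [FiniteDimensional ℝ W] (D : W →ₗ[ℝ] Module.Dual ℝ W) (hD : Function.Injective D) :
    Function.Surjective D :=
  (LinearMap.injective_iff_surjective_of_finrank_eq_finrank Subspace.dual_finrank_eq.symm).1 hD

theorem rank_dual_eq_rank (W : Type) [AddCommGroup W] [Module ℝ W] [FiniteDimensional ℝ W] :
    Module.rank ℝ (Module.Dual ℝ W) = Module.rank ℝ W := by
  rw [← Module.finrank_eq_rank, ← Module.finrank_eq_rank, Subspace.dual_finrank_eq]

theorem toENat_cardinal_sum {ι : Type} [Fintype ι] (c : ι → Cardinal.{0}) :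
    Cardinal.toENat (Cardinal.sum c) = ∑ i, Cardinal.toENat (c i) := by
  by_cases h : ∀ i, c i < Cardinal.aleph0
  · choose n hn using fun i => Cardinal.lt_aleph0.1 (h i)
    obtain rfl : c = fun i => Cardinal.mk (Fin (n i)) := by ext i; rw [hn, Cardinal.mk_fin]
    rw [← Cardinal.mk_sigma, Cardinal.mk_fintype, Fintype.card_sigma]
    simp
  · push Not at h
    obtain ⟨i, hi⟩ := h
    have h1 : Cardinal.toENat (c i) = ⊤ := Cardinal.toENat_eq_top.2 hi
    have h2 := Finset.single_le_sum (f := fun i => Cardinal.toENat (c i))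
      (fun _ _ => zero_le) (Finset.mem_univ i)
    have h3 := Cardinal.toENat.monotone' (Cardinal.le_sum c i)
    change Cardinal.toENat (c i) ≤ Cardinal.toENat _ at h3
    rw [h1, top_le_iff] at h2 h3
    rw [h2, h3]

end LinearAlgebra

section Variational

variable {a b : ℝ}

theorem exists_inner_eq_intervalIntegral {x y : Set.Icc a b} (hxy : x ≤ y) :
    ∃ φ : Lp ℝ 2 (volume.restrict (Set.Icc a b)), ‖φ‖ ≤ √|(x : ℝ) - y| ∧
      ∀ u : Lp ℝ 2 (volume.restrict (Set.Icc a b)), ∫ t in (x : ℝ)..y, u t = inner ℝ φ u := by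
  have hxy' : (x : ℝ) ≤ y := hxy
  have hsub : Set.Ioc (x : ℝ) y ⊆ Set.Icc a b := fun t ht =>
    ⟨x.2.1.trans ht.1.le, ht.2.trans y.2.2⟩
  have e : volume.restrict (Set.Icc a b) (Set.Ioc (x : ℝ) y) = ENNReal.ofReal (y - x) := by
    rw [Measure.restrict_apply measurableSet_Ioc, Set.inter_eq_left.2 hsub, Real.volume_Ioc]
  refine ⟨indicatorConstLp 2 (measurableSet_Ioc (a := (x : ℝ)) (b := y))
    (measure_ne_top _ _) (1 : ℝ), ?_, fun u => ?_⟩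
  · rw [norm_indicatorConstLp (by simp) (by simp), measureReal_def, e,
      ENNReal.toReal_ofReal (by linarith), abs_sub_comm, abs_of_nonneg (by linarith),
      Real.sqrt_eq_rpow]
    simp
  · rw [L2.inner_indicatorConstLp_one, intervalIntegral.integral_of_le hxy',
      Measure.restrict_restrict measurableSet_Ioc, Set.inter_eq_left.2 hsub]

theorem mem_H1_of_le {f : PairSpace a b}
    (h : ∀ x y : Set.Icc a b, x ≤ y → f.1 y - f.1 x = ∫ t in (x : ℝ)..y, f.2 t) : f ∈ H1 a b := by
  intro x y
  rcases le_total x y with hxy | hxy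
  · exact h x y hxy
  · rw [intervalIntegral.integral_symm, ← h y x hxy]; ring

theorem isClosed_H1 : IsClosed (H1 a b : Set (PairSpace a b)) := by
  have : (H1 a b : Set (PairSpace a b)) = ⋂ (x : Set.Icc a b) (y : Set.Icc a b) (_ : x ≤ y),
      {f | f.1 y - f.1 x = ∫ t in (x : ℝ)..y, f.2 t} := by
    ext f
    simp only [Set.mem_iInter]
    exact ⟨fun h x y _ => h x y, mem_H1_of_le⟩
  rw [this]
  refine isClosed_iInter fun x => isClosed_iInter fun y => isClosed_iInter fun hxy => ?_
  obtain ⟨φ, -, hφ⟩ := exists_inner_eq_intervalIntegral hxy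
  simp only [hφ]
  exact isClosed_eq (by fun_prop) (by fun_prop)

theorem isClosed_H1Zero : IsClosed (H1Zero a b : Set (PairSpace a b)) := by
  have : (H1Zero a b : Set (PairSpace a b)) = (H1 a b : Set (PairSpace a b)) ∩ ⋂ (x : Set.Icc a b)
      (_ : (x : ℝ) = a ∨ (x : ℝ) = b), {f | f.1 x = 0} := by
    ext f
    simp only [Set.mem_inter_iff, Set.mem_iInter]
    rfl
  rw [this]
  refine isClosed_H1.inter (isClosed_iInter fun x => isClosed_iInter fun _ => ?_)
  exact isClosed_eq (by fun_prop) (by fun_prop)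

theorem H1Zero_le_H1 : H1Zero a b ≤ H1 a b := fun _ h => h.1

theorem abs_sub_le_of_mem_H1 {f : PairSpace a b} (hf : f ∈ H1 a b) (x y : Set.Icc a b) :
    |f.1 x - f.1 y| ≤ √|(x : ℝ) - y| * ‖f.2‖ := by
  wlog hxy : x ≤ y generalizing x y
  · rw [abs_sub_comm, abs_sub_comm (x : ℝ)]
    exact this y x (le_of_not_ge hxy)
  obtain ⟨φ, hφ, h⟩ := exists_inner_eq_intervalIntegral hxy
  rw [abs_sub_comm, hf x y, h]
  exact (abs_real_inner_le_norm _ _).trans (mul_le_mul_of_nonneg_right hφ (norm_nonneg _))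

theorem energyForm_self (f : PairSpace a b) : energyForm a b f f = ‖f.2‖ ^ 2 := by
  rw [energyForm_eq_inner, real_inner_self_eq_norm_sq]

theorem exists_sq_le_massForm (μ : FiniteMeasure ℝ) [IsProbabilityMeasure (restrictIcc a b μ)]
    (f : PairSpace a b) : ∃ x, f.1 x ^ 2 ≤ massForm μ f f := by
  obtain ⟨x, hx⟩ := exists_le_integral (innerMu_integrable μ f f)
  exact ⟨x, by rw [sq]; exact hx⟩

theorem eq_zero_of_mem_H1 (μ : FiniteMeasure ℝ) [IsProbabilityMeasure (restrictIcc a b μ)]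
    {f : PairSpace a b} (hf : f ∈ H1 a b) (hE : energyForm a b f f = 0)
    (hM : massForm μ f f = 0) : f = 0 := by
  have h2 : f.2 = 0 := by
    rw [energyForm_self] at hE
    exact norm_eq_zero.1 (pow_eq_zero_iff two_ne_zero |>.1 hE)
  obtain ⟨x, hx⟩ := exists_sq_le_massForm μ f
  rw [hM] at hx
  have hx0 : f.1 x = 0 := pow_eq_zero_iff two_ne_zero |>.1 (le_antisymm hx (sq_nonneg _))
  refine Prod.ext (ContinuousMap.ext fun y => ?_) h2
  have := abs_sub_le_of_mem_H1 hf y x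
  rw [h2, norm_zero, mul_zero, hx0, sub_zero] at this
  exact abs_eq_zero.1 (le_antisymm this (abs_nonneg _))

/-- A sequence in `H¹` that is bounded in energy and in `L²(μ)` has a uniformly convergent
subsequence. -/
theorem exists_tendsto_subseq (μ : FiniteMeasure ℝ) [IsProbabilityMeasure (restrictIcc a b μ)]
    {g : ℕ → PairSpace a b} (hg : ∀ n, g n ∈ H1 a b) {C : ℝ} (hC : ∀ n, ‖(g n).2‖ ≤ C)
    (hM : ∀ n, massForm μ (g n) (g n) ≤ 1) :
    ∃ (u : C(Set.Icc a b, ℝ)) (φ : ℕ → ℕ), StrictMono φ ∧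
      Tendsto (fun n => (g (φ n)).1) atTop (𝓝 u) := by
  have hC0 : 0 ≤ C := (norm_nonneg _).trans (hC 0)
  have hh : ∀ n x y, |(g n).1 x - (g n).1 y| ≤ √|(x : ℝ) - y| * C := fun n x y =>
    (abs_sub_le_of_mem_H1 (hg n) x y).trans
      (mul_le_mul_of_nonneg_left (hC n) (Real.sqrt_nonneg _))
  have hbound : ∀ n x, |(g n).1 x| ≤ 1 + √(b - a) * C := by
    intro n x
    obtain ⟨y, hy⟩ := exists_sq_le_massForm μ (g n)
    have h1 : |(g n).1 y| ≤ 1 := by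
      rw [← sq_le_one_iff_abs_le_one]
      exact hy.trans (hM n)
    have h2 := hh n x y
    have h3 : √|(x : ℝ) - y| ≤ √(b - a) := by
      refine Real.sqrt_le_sqrt (abs_le.2 ⟨?_, ?_⟩) <;> linarith [x.2.1, x.2.2, y.2.1, y.2.2]
    have h4 := mul_le_mul_of_nonneg_right h3 hC0
    have h5 := abs_add_le ((g n).1 x - (g n).1 y) ((g n).1 y)
    rw [sub_add_cancel] at h5
    linarith
  let F : ℕ → BoundedContinuousFunction (Set.Icc a b) ℝ := fun n =>
    BoundedContinuousFunction.mkOfCompact (g n).1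
  have hcomp : IsCompact (closure (Set.range F)) := by
    refine BoundedContinuousFunction.arzela_ascoli _
      (isCompact_Icc (a := -(1 + √(b - a) * C)) (b := 1 + √(b - a) * C)) _ ?_ ?_
    · rintro _ x ⟨n, rfl⟩
      exact abs_le.1 (hbound n x)
    · refine Metric.equicontinuous_of_continuity_modulus (fun r => √|r| * C) ?_ _ ?_
      · have : Continuous fun r : ℝ => √|r| * C := by fun_prop
        simpa using this.tendsto 0
      · rintro x y ⟨_, n, rfl⟩
        have := hh n x y
        rw [Real.dist_eq, Subtype.dist_eq, Real.dist_eq, abs_abs]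
        exact this
  obtain ⟨u, -, φ, hφ, hu⟩ := hcomp.tendsto_subseq
    (fun n => subset_closure (Set.mem_range_self (f := F) n))
  refine ⟨u.toContinuousMap, φ, hφ, ?_⟩
  have hc : Continuous (ContinuousMap.isometryEquivBoundedOfCompact (Set.Icc a b) ℝ).symm :=
    IsometryEquiv.continuous _
  exact (hc.tendsto u).comp hu

/-- The infimum of the Rayleigh quotient on a closed subspace of `H¹` is attained. -/
theorem exists_rayleigh_minimizer (μ : FiniteMeasure ℝ) [IsProbabilityMeasure (restrictIcc a b μ)]
    {W : Submodule ℝ (PairSpace a b)} (hW : IsClosed (W : Set (PairSpace a b))) (hWH : W ≤ H1 a b)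
    (hne : ∃ f ∈ W, 0 < massForm μ f f) :
    ∃ g ∈ W, massForm μ g g = 1 ∧
      ∀ h ∈ W, energyForm a b g g * massForm μ h h ≤ energyForm a b h h := by
  set T : Set ℝ := {e | ∃ g ∈ W, massForm μ g g = 1 ∧ energyForm a b g g = e}
  have hscale : ∀ h ∈ W, 0 < massForm μ h h →
      energyForm a b h h / massForm μ h h ∈ T := by
    intro h hh hpos
    refine ⟨(√(massForm μ h h))⁻¹ • h, W.smul_mem _ hh, ?_, ?_⟩
    all_goals
      simp only [map_smul, LinearMap.smul_apply, smul_eq_mul]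
      rw [← mul_assoc, ← mul_inv, Real.mul_self_sqrt hpos.le]
    · exact inv_mul_cancel₀ hpos.ne'
    · rw [div_eq_inv_mul]
  have hTne : T.Nonempty := let ⟨f, hf, hpos⟩ := hne; ⟨_, hscale f hf hpos⟩
  have hTbdd : BddBelow T := ⟨0, by rintro _ ⟨g, -, -, rfl⟩; exact energyForm_self_nonneg g⟩
  set l := sInf T
  have hmin : ∀ h ∈ W, l * massForm μ h h ≤ energyForm a b h h := by
    intro h hh
    rcases (massForm_self_nonneg μ h).eq_or_lt with h0 | hpos
    · rw [← h0, mul_zero]; exact energyForm_self_nonneg h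
    · rw [← le_div_iff₀ hpos]
      exact csInf_le hTbdd (hscale h hh hpos)
  obtain ⟨e, -, hlim, he⟩ := exists_seq_tendsto_sInf hTne hTbdd
  choose g hgW hgM hgE using he
  have hnorm : ∀ n, ‖(g n).2‖ ^ 2 = e n := fun n => by rw [← energyForm_self, hgE]
  obtain ⟨B, hB⟩ := hlim.bddAbove_range
  obtain ⟨u, φ, hφ, hu⟩ := exists_tendsto_subseq μ (fun n => hWH (hgW n)) (C := √B)
    (fun n => Real.le_sqrt_of_sq_le (by rw [hnorm]; exact hB ⟨n, rfl⟩)) (fun n => (hgM n).le)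
  have hlim' : Tendsto (fun n => e (φ n)) atTop (𝓝 l) := hlim.comp hφ.tendsto_atTop
  have hcauchy : CauchySeq fun n => (g (φ n)).2 := by
    rw [cauchySeq_iff_tendsto_dist_atTop_0]
    have hle : ∀ p : ℕ × ℕ, dist (g (φ p.1)).2 (g (φ p.2)).2
        ≤ √(2 * e (φ p.1) + 2 * e (φ p.2)
          - l * massForm μ (g (φ p.1) + g (φ p.2)) (g (φ p.1) + g (φ p.2))) := by
      intro p
      refine Real.le_sqrt_of_sq_le ?_
      have h1 := hmin _ (W.add_mem (hgW (φ p.1)) (hgW (φ p.2)))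
      have h2 := parallelogram_law_with_norm ℝ (g (φ p.1)).2 (g (φ p.2)).2
      rw [energyForm_self, Prod.snd_add] at h1
      rw [dist_eq_norm, ← hnorm, ← hnorm]
      nlinarith
    have hcont : Continuous fun q : C(Set.Icc a b, ℝ) × C(Set.Icc a b, ℝ) =>
        massForm μ ((q.1 + q.2, 0) : PairSpace a b) (q.1 + q.2, 0) := by
      simp only [massForm_eq_inner]; fun_prop
    have hfst : Tendsto (fun p : ℕ × ℕ => ((g (φ p.1)).1, (g (φ p.2)).1)) atTop
        (𝓝 (u, u)) := by
      rw [← prod_atTop_atTop_eq, nhds_prod_eq]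
      exact hu.prodMap hu
    have hmass : Tendsto (fun p : ℕ × ℕ => massForm μ (g (φ p.1) + g (φ p.2))
        (g (φ p.1) + g (φ p.2))) atTop (𝓝 4) := by
      have h1 := (hcont.tendsto (u, u)).comp hfst
      have h2 : massForm μ ((u + u, 0) : PairSpace a b) (u + u, 0) = 4 := by
        have h3 := ((hcont.tendsto (u, u)).comp (hu.prodMk_nhds hu))
        refine tendsto_nhds_unique h3 (tendsto_const_nhds.congr fun n => ?_)
        have h4 : massForm μ (g (φ n) + g (φ n)) (g (φ n) + g (φ n)) = 4 := by
          simp only [map_add, LinearMap.add_apply, hgM]; norm_num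
        exact h4.symm
      rw [← h2]
      exact h1
    have h0 : Tendsto (fun p : ℕ × ℕ => √(2 * e (φ p.1) + 2 * e (φ p.2)
        - l * massForm μ (g (φ p.1) + g (φ p.2)) (g (φ p.1) + g (φ p.2)))) atTop (𝓝 0) := by
      have h1 : Tendsto (fun p : ℕ × ℕ => e (φ p.1)) atTop (𝓝 l) := by
        rw [← prod_atTop_atTop_eq]; exact hlim'.comp tendsto_fst
      have h2 : Tendsto (fun p : ℕ × ℕ => e (φ p.2)) atTop (𝓝 l) := by
        rw [← prod_atTop_atTop_eq]; exact hlim'.comp tendsto_snd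
      have h3 := (((h1.const_mul 2).add (h2.const_mul 2)).sub (hmass.const_mul l)).sqrt
      have h4 : √(2 * l + 2 * l - l * 4) = 0 := by rw [Real.sqrt_eq_zero']; linarith
      rwa [h4] at h3
    exact squeeze_zero (fun _ => dist_nonneg) hle h0
  obtain ⟨v, hv⟩ := cauchySeq_tendsto_of_complete hcauchy
  have hg : Tendsto (fun n => g (φ n)) atTop (𝓝 ((u, v) : PairSpace a b)) := hu.prodMk_nhds hv
  have hgg := hg.prodMk_nhds hg
  have hE : energyForm a b ((u, v) : PairSpace a b) (u, v) = l := by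
    refine tendsto_nhds_unique ((continuous_energyForm.tendsto _).comp hgg) (hlim'.congr fun n => ?_)
    exact (hgE _).symm
  refine ⟨(u, v), hW.mem_of_tendsto hg (Eventually.of_forall fun n => hgW _), ?_, ?_⟩
  · refine tendsto_nhds_unique (((continuous_massForm μ).tendsto _).comp hgg)
      (tendsto_const_nhds.congr fun n => ?_)
    exact (hgM _).symm
  · rw [hE]; exact hmin

/-- A function that is orthogonal to all eigenfunctions of eigenvalues `≤ x` has a Rayleigh
quotient larger than `x`. -/
theorem lt_energyForm_of_orthogonal (μ : FiniteMeasure ℝ)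
    [IsProbabilityMeasure (restrictIcc a b μ)] {V : Submodule ℝ (PairSpace a b)}
    (hV : IsClosed (V : Set (PairSpace a b))) (hVH : V ≤ H1 a b) {x : ℝ}
    [FiniteDimensional ℝ (lowSpace V μ x)] {f : PairSpace a b} (hf : f ∈ V) (hf0 : f ≠ 0)
    (horth : ∀ p ∈ lowSpace V μ x, massForm μ f p = 0) :
    x * massForm μ f f < energyForm a b f f := by
  by_contra! hcon
  set P := lowSpace V μ x
  have hPV : P ≤ V := lowSpace_le V μ x
  have hdef : ∀ p ∈ P, massForm μ p p = 0 → p = 0 := fun p hp h0 =>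
    eq_zero_of_mem_H1 μ (hVH (hPV hp)) (le_antisymm
      (by simpa [h0] using energyForm_le_of_mem_lowSpace hp) (energyForm_self_nonneg p)) h0
  have hfpos : 0 < massForm μ f f := by
    refine (massForm_self_nonneg μ f).lt_of_ne' fun h0 => hf0 ?_
    exact eq_zero_of_mem_H1 μ (hVH hf)
      (le_antisymm (by simpa [h0] using hcon) (energyForm_self_nonneg f)) h0
  let W : Submodule ℝ (PairSpace a b) :=
    { carrier := {h | h ∈ V ∧ ∀ p ∈ P, massForm μ h p = 0}
      zero_mem' := ⟨V.zero_mem, fun p _ => by simp⟩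
      add_mem' := fun {h h'} hh hh' => ⟨V.add_mem hh.1 hh'.1, fun p hp => by
        simp [hh.2 p hp, hh'.2 p hp]⟩
      smul_mem' := fun c h hh => ⟨V.smul_mem c hh.1, fun p hp => by simp [hh.2 p hp]⟩ }
  have hWc : IsClosed (W : Set (PairSpace a b)) := by
    have : (W : Set (PairSpace a b)) = (V : Set (PairSpace a b)) ∩ ⋂ p ∈ P, {h | massForm μ h p = 0} := by
      ext h
      simp only [Set.mem_inter_iff, Set.mem_iInter]
      rfl
    rw [this]
    refine hV.inter (isClosed_biInter fun p _ => isClosed_eq ?_ continuous_const)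
    exact (continuous_massForm μ).comp (by fun_prop : Continuous fun h : PairSpace a b => (h, p))
  obtain ⟨g, hg, hg1, hmin⟩ := exists_rayleigh_minimizer μ hWc (fun h hh => hVH hh.1)
    ⟨f, ⟨hf, horth⟩, hfpos⟩
  set l := energyForm a b g g with hl
  have hlx : l ≤ x := le_of_mul_le_mul_right ((hmin f ⟨hf, horth⟩).trans hcon) hfpos
  have hEL : ∀ h ∈ W, energyForm a b g h = l * massForm μ g h := by
    intro h hh
    let Q : LinearMap.BilinForm ℝ W := (energyForm a b - l • massForm μ).domRestrict₁₂ W W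
    have hQ : ∀ h h' : W, Q h h' = energyForm a b h h' - l * massForm μ (h : PairSpace a b) h' :=
      fun _ _ => rfl
    have hCS := LinearMap.BilinForm.apply_sq_le_of_symm Q
      (fun h => by rw [hQ]; linarith [hmin h h.2])
      ⟨fun h h' => by
        rw [RingHom.id_apply, hQ, hQ, energyForm_comm, massForm_comm]⟩ ⟨g, hg⟩ ⟨h, hh⟩
    rw [hQ, hQ] at hCS
    simp only [hg1, ← hl, mul_one, sub_self, zero_mul] at hCS
    have := pow_eq_zero_iff two_ne_zero |>.1 (le_antisymm hCS (sq_nonneg _))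
    linarith
  have hEP : ∀ p ∈ P, energyForm a b g p = 0 := by
    intro p hp
    refine Submodule.iSup_induction (fun k : Set.Iic x => eigenspace V μ k)
      (motive := fun p => energyForm a b g p = 0) hp ?_ (map_zero _)
      (fun p q hp hq => by rw [map_add, hp, hq, add_zero])
    intro k p hpk
    have h1 := (mem_eigenspace.1 hpk).2 g hg.1
    rw [energyForm_comm, h1, massForm_comm, hg.2 p (eigenspace_le_lowSpace V μ k.2 hpk), mul_zero]
  have hdecomp : ∀ h ∈ V, ∃ p ∈ P, h - p ∈ W := by
    intro h hh
    let D : P →ₗ[ℝ] Module.Dual ℝ P := (massForm μ).domRestrict₁₂ P P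
    have hD : Function.Injective D := by
      rw [← LinearMap.ker_eq_bot, LinearMap.ker_eq_bot']
      intro p hp
      exact Subtype.ext (hdef p p.2 (LinearMap.congr_fun hp p))
    have hsurj : Function.Surjective D := surjective_of_injective_to_dual D hD
    obtain ⟨p, hp⟩ := hsurj ((massForm μ h).comp P.subtype)
    refine ⟨p, p.2, V.sub_mem hh (hPV p.2), fun q hq => ?_⟩
    have : massForm μ (p : PairSpace a b) q = massForm μ h q := LinearMap.congr_fun hp ⟨q, hq⟩
    rw [map_sub, LinearMap.sub_apply, this, sub_self]
  have hgeig : g ∈ eigenspace V μ l := by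
    refine mem_eigenspace.2 ⟨hg.1, fun h hh => ?_⟩
    obtain ⟨p, hp, hpW⟩ := hdecomp h hh
    have h1 := hEL _ hpW
    rw [map_sub, map_sub, hEP p hp, hg.2 p hp, sub_zero, sub_zero] at h1
    exact h1
  have := hg.2 g (eigenspace_le_lowSpace V μ hlx hgeig)
  rw [hg1] at this
  exact one_ne_zero this

/-- The dimension of a space that is mapped to several form domains in such a way that only `0` has
small Rayleigh quotients everywhere is at most the sum of the eigenvalue counts. -/
theorem toENat_rank_le_sum_eigenvalueCount {U ι : Type} [AddCommGroup U] [Module ℝ U] [Fintype ι]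
    {V : ι → Submodule ℝ (PairSpace a b)} {μ : ι → FiniteMeasure ℝ} {x : ι → ℝ}
    (hμ : ∀ i, IsProbabilityMeasure (restrictIcc a b (μ i)))
    (hV : ∀ i, IsClosed (V i : Set (PairSpace a b))) (hVH : ∀ i, V i ≤ H1 a b)
    (L : ι → U →ₗ[ℝ] PairSpace a b) (hL : ∀ i f, L i f ∈ V i)
    (h : ∀ f, (∀ i, L i f = 0 ∨
      x i * massForm (μ i) (L i f) (L i f) < energyForm a b (L i f) (L i f)) → f = 0) :
    Cardinal.toENat (Module.rank ℝ U) ≤ ∑ i, eigenvalueCount (V i) (μ i) (x i) := by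
  by_cases htop : ∃ i, eigenvalueCount (V i) (μ i) (x i) = ⊤
  · obtain ⟨i, hi⟩ := htop
    have := Finset.single_le_sum (f := fun i => eigenvalueCount (V i) (μ i) (x i))
      (fun _ _ => zero_le) (Finset.mem_univ i)
    rw [hi] at this
    exact le_top.trans this
  push Not at htop
  have hcount : ∀ i, Cardinal.toENat (Module.rank ℝ (lowSpace (V i) (μ i) (x i)))
      = eigenvalueCount (V i) (μ i) (x i) := fun i =>
    toENat_rank_lowSpace (fun f hf => have := hμ i; eq_zero_of_mem_H1 (μ i) (hVH i hf)) (x i)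
  have hfin : ∀ i, FiniteDimensional ℝ (lowSpace (V i) (μ i) (x i)) := fun i => by
    rw [FiniteDimensional, ← Module.rank_lt_aleph0_iff, ← Cardinal.toENat_lt_top, hcount]
    exact (htop i).lt_top
  let D : U →ₗ[ℝ] ∀ i, Module.Dual ℝ (lowSpace (V i) (μ i) (x i)) :=
    LinearMap.pi fun i => ((massForm (μ i)).domRestrict₂ (lowSpace (V i) (μ i) (x i))).comp (L i)
  have hD : Function.Injective D := by
    rw [← LinearMap.ker_eq_bot, LinearMap.ker_eq_bot']
    intro f hf
    refine h f fun i => or_iff_not_imp_left.2 fun h0 => ?_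
    have := hμ i
    refine lt_energyForm_of_orthogonal (μ i) (hV i) (hVH i) (hL i f) h0 fun p hp => ?_
    exact LinearMap.congr_fun (congrFun hf i) ⟨p, hp⟩
  have hle := Cardinal.toENat.monotone' (LinearMap.rank_le_of_injective D hD)
  refine hle.trans (le_of_eq ?_)
  change Cardinal.toENat _ = _
  rw [rank_pi]
  have hdual : ∀ i, Module.rank ℝ (Module.Dual ℝ (lowSpace (V i) (μ i) (x i)))
      = Module.rank ℝ (lowSpace (V i) (μ i) (x i)) := fun i => by
    exact rank_dual_eq_rank _
  simp only [hdual, toENat_cardinal_sum, hcount]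

end Variational

end RecursiveCantor

namespace RecursiveCantor

section Pullback

variable {a b : ℝ}

/-- The continuous extension of a function on `[a, b]` that is constant on both sides. -/
noncomputable def extend (hab : a < b) (f : C(Set.Icc a b, ℝ)) (x : ℝ) : ℝ :=
  f (Set.projIcc a b hab.le x)

theorem continuous_extend (hab : a < b) (f : C(Set.Icc a b, ℝ)) : Continuous (extend hab f) :=
  f.continuous.comp continuous_projIcc

theorem extend_coe (hab : a < b) (f : C(Set.Icc a b, ℝ)) (x : Set.Icc a b) :
    extend hab f x = f x := by
  rw [extend, Set.projIcc_val]

/-- The extension of a function on `[a, b]` by zero. -/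
noncomputable def extendZero (u : Lp ℝ 2 (volume.restrict (Set.Icc a b))) : ℝ → ℝ :=
  (Set.Icc a b).indicator u

theorem memLp_extendZero (u : Lp ℝ 2 (volume.restrict (Set.Icc a b))) :
    MemLp (extendZero u) 2 volume :=
  (memLp_indicator_iff_restrict measurableSet_Icc).2 (Lp.memLp u)

theorem integrable_extendZero (u : Lp ℝ 2 (volume.restrict (Set.Icc a b))) :
    Integrable (extendZero u) volume :=
  (integrable_indicator_iff measurableSet_Icc).2 ((Lp.memLp u).integrable (by norm_num))

theorem extendZero_add (u v : Lp ℝ 2 (volume.restrict (Set.Icc a b))) :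
    extendZero (u + v) =ᵐ[volume] extendZero u + extendZero v := by
  have h := Lp.coeFn_add u v
  rw [Filter.EventuallyEq, ae_restrict_iff' measurableSet_Icc] at h
  filter_upwards [h] with t ht
  by_cases hm : t ∈ Set.Icc a b
  · simp only [extendZero, Pi.add_apply, Set.indicator_of_mem hm, ht hm]
  · simp [extendZero, Set.indicator_of_notMem hm]

theorem extendZero_smul (k : ℝ) (u : Lp ℝ 2 (volume.restrict (Set.Icc a b))) :
    extendZero (k • u) =ᵐ[volume] k • extendZero u := by
  have h := Lp.coeFn_smul k u
  rw [Filter.EventuallyEq, ae_restrict_iff' measurableSet_Icc] at h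
  filter_upwards [h] with t ht
  by_cases hm : t ∈ Set.Icc a b
  · simp only [extendZero, Pi.smul_apply, Set.indicator_of_mem hm, ht hm]
  · simp [extendZero, Set.indicator_of_notMem hm]

theorem extend_sub_extend (hab : a < b) {f : PairSpace a b} (hf : f ∈ H1 a b) (x y : ℝ) :
    extend hab f.1 y - extend hab f.1 x = ∫ t in x..y, extendZero f.2 t := by
  have hint : ∀ x y : ℝ, IntervalIntegrable (extendZero f.2) volume x y := fun _ _ =>
    (integrable_extendZero f.2).intervalIntegrable
  have hproj : ∀ x : ℝ, ∫ t in x..(Set.projIcc a b hab.le x : ℝ), extendZero f.2 t = 0 := by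
    intro x
    by_cases hx : x ∈ Set.Icc a b
    · rw [Set.projIcc_of_mem hab.le hx, intervalIntegral.integral_same]
    rw [intervalIntegral.integral_congr_ae (g := fun _ => (0 : ℝ)), intervalIntegral.integral_zero]
    rcases lt_or_ge x a with h | h
    · rw [Set.projIcc_of_le_left hab.le h.le]
      filter_upwards [Measure.ae_ne volume a] with t hta ht
      rw [Set.uIoc_of_le h.le] at ht
      exact Set.indicator_of_notMem (fun hm => hta (le_antisymm ht.2 hm.1)) _
    · have h' : b < x := lt_of_not_ge fun h' => hx ⟨h, h'⟩
      rw [Set.projIcc_of_right_le hab.le h'.le]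
      refine Eventually.of_forall fun t ht => ?_
      rw [Set.uIoc_of_ge h'.le] at ht
      exact Set.indicator_of_notMem (fun hm => not_lt.2 hm.2 ht.1) _
  set p := Set.projIcc a b hab.le x with hp
  set q := Set.projIcc a b hab.le y with hq
  have h1 : ∫ t in (p : ℝ)..q, extendZero f.2 t = ∫ t in (p : ℝ)..q, f.2 t := by
    refine intervalIntegral.integral_congr fun t ht => ?_
    exact Set.indicator_of_mem (Set.uIcc_subset_Icc p.2 q.2 ht) _
  have h2 := hproj y
  rw [intervalIntegral.integral_symm, neg_eq_zero] at h2
  rw [← intervalIntegral.integral_add_adjacent_intervals (hint x p) (hint p y),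
    ← intervalIntegral.integral_add_adjacent_intervals (hint p q) (hint q y), hproj x, h2, h1,
    ← hf p q]
  simp [extend, hp, hq]

theorem quasiMeasurePreserving_affine {ρ : ℝ} (hρ : 0 < ρ) (γ : ℝ) :
    Measure.QuasiMeasurePreserving (fun x => ρ * x + γ) volume volume :=
  ⟨by fun_prop, by
    rw [map_affine_volume hρ]; exact Measure.smul_absolutelyContinuous⟩

theorem measurableEmbedding_affine {ρ : ℝ} (hρ : 0 < ρ) (γ : ℝ) :
    MeasurableEmbedding (fun x : ℝ => ρ * x + γ) :=
  Continuous.measurableEmbedding (by fun_prop) fun x y h => by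
    have h' : ρ * x + γ = ρ * y + γ := h
    exact mul_left_cancel₀ hρ.ne' (add_right_cancel h')

theorem setIntegral_comp_affine {ρ : ℝ} (hρ : 0 < ρ) (γ : ℝ) (s : Set ℝ) (f : ℝ → ℝ) :
    ∫ x in (fun x => ρ * x + γ) ⁻¹' s, f (ρ * x + γ) = ρ⁻¹ * ∫ x in s, f x := by
  rw [← (measurableEmbedding_affine hρ γ).setIntegral_map, map_affine_volume hρ,
    Measure.restrict_smul, integral_smul_measure, ENNReal.toReal_ofReal (inv_pos.2 hρ).le,
    smul_eq_mul]

theorem memLp_comp_affine {ρ : ℝ} (hρ : 0 < ρ) (γ : ℝ)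
    (u : Lp ℝ 2 (volume.restrict (Set.Icc a b))) :
    MemLp (fun t => ρ * extendZero u (ρ * t + γ)) 2 (volume.restrict (Set.Icc a b)) := by
  have h : MemLp (extendZero u) 2 (Measure.map (fun x => ρ * x + γ) volume) := by
    rw [map_affine_volume hρ]
    exact (memLp_extendZero u).smul_measure ENNReal.ofReal_ne_top
  exact (((measurableEmbedding_affine hρ γ).memLp_map_measure_iff.1 h).const_mul ρ).restrict _

/-- The composition of an element of `H¹` with the affine map `x ↦ ρ x + γ`, where functions are
extended from `[a, b]` to the line as constants on both sides. -/
noncomputable def pullback (hab : a < b) {ρ : ℝ} (hρ : 0 < ρ) (γ : ℝ) :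
    PairSpace a b →ₗ[ℝ] PairSpace a b where
  toFun f := (⟨fun x => extend hab f.1 (ρ * x + γ),
      (continuous_extend hab f.1).comp (by fun_prop)⟩, (memLp_comp_affine hρ γ f.2).toLp _)
  map_add' f g := by
    refine Prod.ext (ContinuousMap.ext fun x => rfl) ?_
    change MemLp.toLp _ (memLp_comp_affine hρ γ (f.2 + g.2))
      = MemLp.toLp _ (memLp_comp_affine hρ γ f.2) + MemLp.toLp _ (memLp_comp_affine hρ γ g.2)
    rw [← MemLp.toLp_add]
    refine MemLp.toLp_congr _ _ (ae_restrict_of_ae ?_)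
    filter_upwards [(quasiMeasurePreserving_affine hρ γ).ae_eq_comp (extendZero_add f.2 g.2)]
      with t ht
    simp only [Function.comp_apply, Pi.add_apply] at ht ⊢
    rw [ht, mul_add]
  map_smul' k f := by
    refine Prod.ext (ContinuousMap.ext fun x => rfl) ?_
    change MemLp.toLp _ (memLp_comp_affine hρ γ (k • f.2)) 
      = k • MemLp.toLp _ (memLp_comp_affine hρ γ f.2)
    rw [← MemLp.toLp_const_smul]
    refine MemLp.toLp_congr _ _ (ae_restrict_of_ae ?_)
    filter_upwards [(quasiMeasurePreserving_affine hρ γ).ae_eq_comp (extendZero_smul k f.2)]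
      with t ht
    simp only [Function.comp_apply, Pi.smul_apply, smul_eq_mul] at ht ⊢
    rw [ht]; ring

theorem pullback_fst_apply (hab : a < b) {ρ : ℝ} (hρ : 0 < ρ) (γ : ℝ) (f : PairSpace a b)
    (x : Set.Icc a b) : (pullback hab hρ γ f).1 x = extend hab f.1 (ρ * x + γ) := rfl

theorem pullback_snd_ae (hab : a < b) {ρ : ℝ} (hρ : 0 < ρ) (γ : ℝ) (f : PairSpace a b) :
    ∀ᵐ t, t ∈ Set.Icc a b → (pullback hab hρ γ f).2 t = ρ * extendZero f.2 (ρ * t + γ) :=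
  (ae_restrict_iff' measurableSet_Icc).1 (memLp_comp_affine hρ γ f.2).coeFn_toLp

theorem pullback_mem_H1 (hab : a < b) {ρ : ℝ} (hρ : 0 < ρ) (γ : ℝ) {f : PairSpace a b}
    (hf : f ∈ H1 a b) : pullback hab hρ γ f ∈ H1 a b := by
  intro x y
  rw [pullback_fst_apply, pullback_fst_apply, extend_sub_extend hab hf,
    ← intervalIntegral.mul_integral_comp_mul_add, ← intervalIntegral.integral_const_mul]
  refine intervalIntegral.integral_congr_ae ?_
  filter_upwards [pullback_snd_ae hab hρ γ f] with t ht hm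
  exact (ht (Set.uIcc_subset_Icc x.2 y.2 (Set.uIoc_subset_uIcc hm))).symm

theorem energyForm_pullback (hab : a < b) {ρ : ℝ} (hρ : 0 < ρ) (γ : ℝ) (f : PairSpace a b) :
    energyForm a b (pullback hab hρ γ f) (pullback hab hρ γ f)
      = ρ * ∫ t in Set.Icc (ρ * a + γ) (ρ * b + γ), extendZero f.2 t ^ 2 := by
  have hpre : (fun x => ρ * x + γ) ⁻¹' Set.Icc (ρ * a + γ) (ρ * b + γ) = Set.Icc a b := by
    ext x
    simp only [Set.mem_preimage, Set.mem_Icc]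
    constructor <;> rintro ⟨h1, h2⟩ <;> constructor <;> nlinarith
  have h := setIntegral_comp_affine hρ γ (Set.Icc (ρ * a + γ) (ρ * b + γ))
    (fun t => extendZero f.2 t ^ 2)
  rw [hpre] at h
  have h1 : energyForm a b (pullback hab hρ γ f) (pullback hab hρ γ f)
      = ∫ t in Set.Icc a b, ρ ^ 2 * extendZero f.2 (ρ * t + γ) ^ 2 := by
    rw [energyForm_apply, energy]
    refine setIntegral_congr_ae measurableSet_Icc ?_
    filter_upwards [pullback_snd_ae hab hρ γ f] with t ht hm
    rw [ht hm]; ring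
  rw [h1, integral_const_mul, h]
  field_simp

theorem energyForm_pullback_eq_zero (hab : a < b) {ρ ρ' : ℝ} (hρ : 0 < ρ) (hρ' : 0 < ρ')
    (γ γ' : ℝ) (f g : PairSpace a b) {z : ℝ}
    (h : ∀ t, ρ * t + γ ∈ Set.Icc a b → ρ' * t + γ' ∈ Set.Icc a b → t = z) :
    energyForm a b (pullback hab hρ γ f) (pullback hab hρ' γ' g) = 0 := by
  rw [energyForm_apply, energy]
  refine setIntegral_eq_zero_of_ae_eq_zero ?_
  filter_upwards [pullback_snd_ae hab hρ γ f, pullback_snd_ae hab hρ' γ' g,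
    Measure.ae_ne volume z] with t h1 h2 hz hm
  rw [h1 hm, h2 hm]
  by_cases h3 : ρ * t + γ ∈ Set.Icc a b
  · by_cases h4 : ρ' * t + γ' ∈ Set.Icc a b
    · exact absurd (h t h3 h4) hz
    · simp [extendZero, Set.indicator_of_notMem h4]
  · simp [extendZero, Set.indicator_of_notMem h3]

theorem setIntegral_extendZero_sq (f : PairSpace a b) {s : Set ℝ}
    (hs : Set.Icc a b ⊆ s) : ∫ t in s, extendZero f.2 t ^ 2 = energyForm a b f f := by
  have h : (fun t => extendZero f.2 t ^ 2) = (Set.Icc a b).indicator fun t => f.2 t * f.2 t := by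
    ext t
    by_cases ht : t ∈ Set.Icc a b <;> simp [extendZero, ht, sq]
  rw [h, setIntegral_indicator measurableSet_Icc, Set.inter_eq_right.2 hs]
  rfl

end Pullback

section SelfSimilar

variable {a b : ℝ} {J : Type*}

namespace WeightedIFS

variable (s : WeightedIFS a b)

/-- The restriction of `f` to the `i`-th cell, transported to `[a, b]`. -/
noncomputable def restrictCell (hab : a < b) (i : Finset.Icc 1 s.N) :
    PairSpace a b →ₗ[ℝ] PairSpace a b :=
  pullback hab (s.r_pos i.2) (s.c i)

/-- The function `f` transported to the `i`-th cell, and extended as a constant on both sides. -/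
noncomputable def extendCell (hab : a < b) (i : Finset.Icc 1 s.N) :
    PairSpace a b →ₗ[ℝ] PairSpace a b :=
  pullback hab (inv_pos.2 (s.r_pos i.2)) (-((s.r i)⁻¹ * s.c i))

theorem inv_map_mem_Icc_iff (i : Finset.Icc 1 s.N) (t : ℝ) :
    (s.r i)⁻¹ * t + -((s.r i)⁻¹ * s.c i) ∈ Set.Icc a b ↔ t ∈ Set.Icc (s.map i a) (s.map i b) := by
  have hr := s.r_pos i.2
  have e : (s.r i)⁻¹ * t + -((s.r i)⁻¹ * s.c i) = (t - s.c i) / s.r i := by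
    field_simp; ring
  rw [e, Set.mem_Icc, Set.mem_Icc, le_div_iff₀ hr, div_le_iff₀ hr, map, map]
  constructor <;> rintro ⟨h1, h2⟩ <;> constructor <;> linarith

theorem inv_map_le_left (i : Finset.Icc 1 s.N) {t : ℝ} (ht : t ≤ s.map i a) :
    (s.r i)⁻¹ * t + -((s.r i)⁻¹ * s.c i) ≤ a := by
  have hr := s.r_pos i.2
  have e : (s.r i)⁻¹ * t + -((s.r i)⁻¹ * s.c i) = (t - s.c i) / s.r i := by
    field_simp; ring
  rw [e, div_le_iff₀ hr]
  unfold map at ht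
  linarith

theorem right_le_inv_map (i : Finset.Icc 1 s.N) {t : ℝ} (ht : s.map i b ≤ t) :
    b ≤ (s.r i)⁻¹ * t + -((s.r i)⁻¹ * s.c i) := by
  have hr := s.r_pos i.2
  have e : (s.r i)⁻¹ * t + -((s.r i)⁻¹ * s.c i) = (t - s.c i) / s.r i := by
    field_simp; ring
  rw [e, le_div_iff₀ hr]
  unfold map at ht
  linarith

theorem extend_eq_zero_of_le (hab : a < b) {f : PairSpace a b} (hf : f ∈ H1Zero a b) {x : ℝ}
    (hx : x ≤ a) : extend hab f.1 x = 0 := by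
  rw [extend, Set.projIcc_of_le_left hab.le hx]
  exact hf.2 _ (Or.inl rfl)

theorem extend_eq_zero_of_ge (hab : a < b) {f : PairSpace a b} (hf : f ∈ H1Zero a b) {x : ℝ}
    (hx : b ≤ x) : extend hab f.1 x = 0 := by
  rw [extend, Set.projIcc_of_right_le hab.le hx]
  exact hf.2 _ (Or.inr rfl)

theorem extendCell_mem_H1Zero (hab : a < b) (i : Finset.Icc 1 s.N) {f : PairSpace a b}
    (hf : f ∈ H1Zero a b) : s.extendCell hab i f ∈ H1Zero a b := by
  refine ⟨pullback_mem_H1 hab _ _ hf.1, fun x hx => ?_⟩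
  rw [extendCell, pullback_fst_apply]
  rcases hx with hx | hx
  · refine extend_eq_zero_of_le hab hf (s.inv_map_le_left i ?_)
    rw [hx]
    exact (s.map_mem_Icc hab i.2 (Set.left_mem_Icc.2 hab.le)).1
  · refine extend_eq_zero_of_ge hab hf (s.right_le_inv_map i ?_)
    rw [hx]
    exact (s.map_mem_Icc hab i.2 (Set.right_mem_Icc.2 hab.le)).2

theorem energyForm_extendCell_self (hab : a < b) (i : Finset.Icc 1 s.N) (f : PairSpace a b) :
    energyForm a b (s.extendCell hab i f) (s.extendCell hab i f)
      = (s.r i)⁻¹ * energyForm a b f f := by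
  rw [extendCell, energyForm_pullback, setIntegral_extendZero_sq]
  refine Set.Icc_subset_Icc (s.inv_map_le_left i ?_) (s.right_le_inv_map i ?_)
  · exact (s.map_mem_Icc hab i.2 (Set.left_mem_Icc.2 hab.le)).1
  · exact (s.map_mem_Icc hab i.2 (Set.right_mem_Icc.2 hab.le)).2

theorem energyForm_extendCell_of_ne (hab : a < b) {i j : Finset.Icc 1 s.N} (hij : i ≠ j)
    (f g : PairSpace a b) :
    energyForm a b (s.extendCell hab i f) (s.extendCell hab j g) = 0 := by
  wlog h : (i : ℕ) < j generalizing i j f g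
  · rw [energyForm_comm]
    exact this hij.symm g f (lt_of_le_of_ne (not_lt.1 h) fun e => hij (Subtype.ext e.symm))
  refine energyForm_pullback_eq_zero hab _ _ _ _ f g (z := s.map i b) fun t h1 h2 => ?_
  rw [inv_map_mem_Icc_iff] at h1 h2
  exact le_antisymm h1.2 ((s.map_right_le_map_left hab i.2 j.2 h).trans h2.1)

theorem restrictCell_extendCell_fst (hab : a < b) (i j : Finset.Icc 1 s.N) {f : PairSpace a b}
    (hf : f ∈ H1Zero a b) :
    (s.restrictCell hab j (s.extendCell hab i f)).1 = if i = j then f.1 else 0 := by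
  ext x
  have hx := s.map_mem_Icc hab j.2 x.2
  rw [restrictCell, pullback_fst_apply]
  change extend hab _ (s.map j x) = _
  rw [extend_coe hab _ ⟨s.map j x, hx⟩, extendCell, pullback_fst_apply]
  simp only
  have hja : s.map j a ≤ s.map j x := s.map_mono j.2 x.2.1
  have hjb : s.map j x ≤ s.map j b := s.map_mono j.2 x.2.2
  split_ifs with hij
  · subst hij
    have e : (s.r i)⁻¹ * s.map i x + -((s.r i)⁻¹ * s.c i) = x := by
      have := (s.r_pos i.2).ne'
      unfold map; field_simp; ring
    rw [e, extend_coe]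
  · rcases lt_or_gt_of_ne (fun e : (i : ℕ) = j => hij (Subtype.ext e)) with h | h
    · exact extend_eq_zero_of_ge hab hf
        (s.right_le_inv_map i ((s.map_right_le_map_left hab i.2 j.2 h).trans hja))
    · exact extend_eq_zero_of_le hab hf
        (s.inv_map_le_left i (hjb.trans (s.map_right_le_map_left hab j.2 i.2 h)))

theorem sum_energyForm_restrictCell_le (hab : a < b) (f : PairSpace a b) :
    ∑ i : Finset.Icc 1 s.N, (s.r i)⁻¹ *
      energyForm a b (s.restrictCell hab i f) (s.restrictCell hab i f) ≤ energyForm a b f f := by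
  have h : ∀ i : Finset.Icc 1 s.N, (s.r i)⁻¹ *
      energyForm a b (s.restrictCell hab i f) (s.restrictCell hab i f)
      = ∫ t in Set.Ioo (s.map i a) (s.map i b), extendZero f.2 t ^ 2 := by
    intro i
    rw [restrictCell, energyForm_pullback, inv_mul_cancel_left₀ (s.r_pos i.2).ne',
      integral_Icc_eq_integral_Ioo]
    rfl
  have hint : Integrable (fun t => extendZero f.2 t ^ 2) volume :=
    (memLp_extendZero f.2).integrable_sq
  simp only [h]
  rw [← setIntegral_extendZero_sq f subset_rfl, ← integral_biUnion_finset Finset.univ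
    (fun _ _ => measurableSet_Ioo) _ (fun _ _ => hint.integrableOn)]
  · refine setIntegral_mono_set hint.integrableOn (Eventually.of_forall fun t => sq_nonneg _)
      (LE.le.eventuallyLE (Set.iUnion₂_subset fun i _ t ht => ?_))
    exact ⟨(s.map_mem_Icc hab i.2 (Set.left_mem_Icc.2 hab.le)).1.trans ht.1.le,
      ht.2.le.trans (s.map_mem_Icc hab i.2 (Set.right_mem_Icc.2 hab.le)).2⟩
  · intro i _ j _ hij
    change Disjoint (Set.Ioo _ _) (Set.Ioo _ _)
    wlog h : (i : ℕ) < j generalizing i j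
    · exact (this (Finset.mem_coe.2 (Finset.mem_univ j)) (Finset.mem_coe.2 (Finset.mem_univ i)) hij.symm (lt_of_le_of_ne (not_lt.1 h)
        fun e => hij (Subtype.ext e.symm))).symm
    rw [Set.disjoint_left]
    intro t h1 h2
    have := s.map_right_le_map_left hab i.2 j.2 h
    linarith [h1.2, h2.1]

end WeightedIFS

theorem isProbabilityMeasure_restrictIcc (S : J → WeightedIFS a b) (hab : a < b)
    (I : List ℕ → J) : IsProbabilityMeasure (restrictIcc a b (cantorMeasure S I)) := by
  have h1 := isProbabilityMeasure_cantorMeasure S hab I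
  constructor
  rw [(MeasurableEmbedding.subtype_coe measurableSet_Icc).comap_apply, Set.image_univ,
    Subtype.range_coe]
  exact prob_compl_eq_zero_iff measurableSet_Icc |>.1 (cantorMeasure_ae_mem_Icc S hab I)

theorem massForm_congr_fst {μ : FiniteMeasure ℝ} {f g : PairSpace a b} (h : f.1 = g.1) :
    massForm μ f f = massForm μ g g := by
  rw [massForm_eq_inner, massForm_eq_inner, h]

theorem massForm_cantorMeasure (S : J → WeightedIFS a b) (hab : a < b) (I : List ℕ → J)
    (f : PairSpace a b) : massForm (cantorMeasure S I) f f
      = ∫ x, extend hab f.1 x ^ 2 ∂(cantorMeasure S I : Measure ℝ) := by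
  rw [massForm_apply, innerMu]
  have h := integral_subtype_comap (μ := (cantorMeasure S I : Measure ℝ))
    (measurableSet_Icc (a := a) (b := b)) (fun x => extend hab f.1 x ^ 2)
  rw [Measure.restrict_eq_self_of_ae_mem (cantorMeasure_ae_mem_Icc S hab I)] at h
  rw [← h]
  refine integral_congr_ae (Eventually.of_forall fun x => ?_)
  simp only [extend_coe, sq]

theorem massForm_eq_sum (S : J → WeightedIFS a b) (hab : a < b) (I : List ℕ → J)
    (f : PairSpace a b) : massForm (cantorMeasure S I) f f
      = ∑ i : Finset.Icc 1 (S (I [])).N, (S (I [])).m i *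
          massForm (cantorMeasure S (subtree I i)) ((S (I [])).restrictCell hab i f)
            ((S (I [])).restrictCell hab i f) := by
  let F : BoundedContinuousFunction ℝ ℝ :=
    (BoundedContinuousFunction.mkOfCompact (f.1 * f.1)).compContinuous
      ⟨Set.projIcc a b hab.le, continuous_projIcc⟩
  have hF : ∀ x, F x = extend hab f.1 x ^ 2 := fun x => (sq _).symm
  have h := integral_cantorMeasure S hab I F
  simp only [hF] at h
  rw [massForm_cantorMeasure S hab, h, ← Finset.sum_coe_sort]
  refine Finset.sum_congr rfl fun i _ => ?_
  rw [massForm_cantorMeasure S hab]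
  congr 1
  refine integral_congr_ae ?_
  filter_upwards [cantorMeasure_ae_mem_Icc S hab (subtree I i)] with x hx
  rw [extend_coe hab _ ⟨x, hx⟩]
  rfl

theorem countD_eq_toENat (S : J → WeightedIFS a b) (hab : a < b) (I : List ℕ → J) (x : ℝ) :
    countD S I x = Cardinal.toENat (Module.rank ℝ (lowSpace (H1Zero a b) (cantorMeasure S I) x)) :=
  have := isProbabilityMeasure_restrictIcc S hab I
  (toENat_rank_lowSpace (fun _ hf => eq_zero_of_mem_H1 _ (H1Zero_le_H1 hf)) x).symm

theorem countN_eq_toENat (S : J → WeightedIFS a b) (hab : a < b) (I : List ℕ → J) (x : ℝ) :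
    countN S I x = Cardinal.toENat (Module.rank ℝ (lowSpace (H1 a b) (cantorMeasure S I) x)) :=
  have := isProbabilityMeasure_restrictIcc S hab I
  (toENat_rank_lowSpace (fun _ hf => eq_zero_of_mem_H1 _ hf) x).symm

theorem countD_le_countN (S : J → WeightedIFS a b) (hab : a < b) (I : List ℕ → J) (x : ℝ) :
    countD S I x ≤ countN S I x := by
  have hμ := isProbabilityMeasure_restrictIcc S hab I
  rw [countD_eq_toENat S hab]
  refine (toENat_rank_le_sum_eigenvalueCount (ι := Unit) (V := fun _ => H1 a b)
    (μ := fun _ => cantorMeasure S I) (x := fun _ => x) (fun _ => hμ) (fun _ => isClosed_H1)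
    (fun _ => le_rfl) (fun _ => Submodule.subtype _)
    (fun _ f => H1Zero_le_H1 (lowSpace_le _ _ _ f.2)) fun f hf => ?_).trans_eq (by simp; rfl)
  rcases hf () with h | h
  · exact Subtype.ext h
  · exact absurd h (not_lt.2 (energyForm_le_of_mem_lowSpace f.2))

theorem countN_le_sum (S : J → WeightedIFS a b) (hab : a < b) (I : List ℕ → J) (x : ℝ) :
    countN S I x ≤ ∑ i ∈ Finset.Icc 1 (S (I [])).N,
      countN S (subtree I i) ((S (I [])).r i * (S (I [])).m i * x) := by
  have hμ := isProbabilityMeasure_restrictIcc S hab I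
  rw [countN_eq_toENat S hab, ← Finset.sum_coe_sort]
  set s := S (I [])
  refine toENat_rank_le_sum_eigenvalueCount (V := fun _ => H1 a b)
    (μ := fun i : Finset.Icc 1 s.N => cantorMeasure S (subtree I i))
    (x := fun i => s.r i * s.m i * x)
    (fun i => isProbabilityMeasure_restrictIcc S hab _) (fun _ => isClosed_H1)
    (fun _ => le_rfl) (fun i => (s.restrictCell hab i).comp (Submodule.subtype _))
    (fun i f => pullback_mem_H1 hab (s.r_pos i.2) (s.c i) (lowSpace_le _ _ _ f.2)) fun f hf => ?_
  have hE := s.sum_energyForm_restrictCell_le hab f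
  have hM : massForm (cantorMeasure S I) (f : PairSpace a b) f = ∑ i : Finset.Icc 1 s.N,
      s.m i * massForm (cantorMeasure S (subtree I i)) (s.restrictCell hab i (f : PairSpace a b))
        (s.restrictCell hab i (f : PairSpace a b)) := massForm_eq_sum S hab I f
  have hlow := energyForm_le_of_mem_lowSpace f.2
  simp only [LinearMap.comp_apply, Submodule.subtype_apply] at hf
  have hr : ∀ i : Finset.Icc 1 s.N, 0 < (s.r i)⁻¹ := fun i => inv_pos.2 (s.r_pos i.2)
  have hterm : ∀ (i : Finset.Icc 1 s.N) (M : ℝ),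
      (s.r i)⁻¹ * (s.r i * s.m i * x * M) = x * (s.m i * M) := fun i M => by
    have := (s.r_pos i.2).ne'
    field_simp
  have hzero : ∀ i, s.restrictCell hab i (f : PairSpace a b) = 0 := by
    by_contra hcon
    push Not at hcon
    obtain ⟨j, hj⟩ := hcon
    have hlt : x * massForm (cantorMeasure S I) (f : PairSpace a b) f
        < ∑ i : Finset.Icc 1 s.N, (s.r i)⁻¹ * energyForm a b
          (s.restrictCell hab i (f : PairSpace a b)) (s.restrictCell hab i (f : PairSpace a b)) := by
      rw [hM, Finset.mul_sum]
      refine Finset.sum_lt_sum (fun i _ => ?_) ⟨j, Finset.mem_univ j, ?_⟩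
      · rcases hf i with h | h
        · rw [h]; simp
        · rw [← hterm]
          exact mul_le_mul_of_nonneg_left h.le (hr i).le
      · rw [← hterm]
        exact mul_lt_mul_of_pos_left ((hf j).resolve_left hj) (hr j)
    linarith
  have hM0 : massForm (cantorMeasure S I) (f : PairSpace a b) f = 0 := by
    rw [hM]
    refine Finset.sum_eq_zero fun i _ => ?_
    rw [hzero i]; simp
  refine Subtype.ext (eq_zero_of_mem_H1 (cantorMeasure S I) (lowSpace_le _ _ _ f.2) ?_ hM0)
  exact le_antisymm (by rw [hM0, mul_zero] at hlow; exact hlow) (energyForm_self_nonneg _)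

theorem sum_countD_le (S : J → WeightedIFS a b) (hab : a < b) (I : List ℕ → J) (x : ℝ) :
    ∑ i ∈ Finset.Icc 1 (S (I [])).N,
      countD S (subtree I i) ((S (I [])).r i * (S (I [])).m i * x) ≤ countD S I x := by
  have hμ := isProbabilityMeasure_restrictIcc S hab I
  rw [← Finset.sum_coe_sort]
  simp only [countD_eq_toENat S hab (subtree I _)]
  set s := S (I [])
  rw [← toENat_cardinal_sum, ← rank_pi]
  let U := (i : Finset.Icc 1 s.N) →
    lowSpace (H1Zero a b) (cantorMeasure S (subtree I i)) (s.r i * s.m i * x)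
  let L : U →ₗ[ℝ] PairSpace a b := ∑ i : Finset.Icc 1 s.N,
    (s.extendCell hab i).comp ((Submodule.subtype _).comp (LinearMap.proj i))
  have hL : ∀ f : U, L f = ∑ i, s.extendCell hab i (f i : PairSpace a b) := fun f => by
    simp only [L, LinearMap.sum_apply]
    rfl
  have hmem : ∀ (f : U) i, (f i : PairSpace a b) ∈ H1Zero a b := fun f i =>
    lowSpace_le _ _ _ (f i).2
  have hE : ∀ f : U, energyForm a b (L f) (L f)
      = ∑ i : Finset.Icc 1 s.N, (s.r i)⁻¹ * energyForm a b (f i : PairSpace a b) (f i) := by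
    intro f
    simp only [hL, map_sum, LinearMap.sum_apply]
    refine Finset.sum_congr rfl fun i _ => ?_
    rw [Finset.sum_eq_single_of_mem i (Finset.mem_univ i), s.energyForm_extendCell_self]
    intro j _ hji
    exact s.energyForm_extendCell_of_ne hab hji _ _
  have hM : ∀ f : U, massForm (cantorMeasure S I) (L f) (L f)
      = ∑ i : Finset.Icc 1 s.N, s.m i * massForm (cantorMeasure S (subtree I i)) (f i : PairSpace a b) (f i) := by
    intro f
    refine (massForm_eq_sum S hab I (L f)).trans ?_
    change ∑ i : Finset.Icc 1 s.N, s.m i * massForm (cantorMeasure S (subtree I i))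
      (s.restrictCell hab i (L f)) (s.restrictCell hab i (L f)) = _
    refine Finset.sum_congr rfl fun j _ => ?_
    congr 1
    refine massForm_congr_fst ?_
    rw [hL, map_sum, Prod.fst_sum]
    simp only [s.restrictCell_extendCell_fst hab _ j (hmem f _)]
    simp
  refine (toENat_rank_le_sum_eigenvalueCount (U := U) (ι := Unit) (V := fun _ => H1Zero a b)
    (μ := fun _ => cantorMeasure S I) (x := fun _ => x) (fun _ => hμ) (fun _ => isClosed_H1Zero)
    (fun _ => H1Zero_le_H1) (fun _ => L) (fun _ f => ?_) fun f hf => ?_).trans_eq (by simp; rfl)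
  · rw [hL]
    exact Submodule.sum_mem _ fun i _ => s.extendCell_mem_H1Zero hab i (hmem f i)
  · have hr : ∀ i : Finset.Icc 1 s.N, 0 < (s.r i)⁻¹ := fun i => inv_pos.2 (s.r_pos i.2)
    have hle : energyForm a b (L f) (L f) ≤ x * massForm (cantorMeasure S I) (L f) (L f) := by
      rw [hE, hM, Finset.mul_sum]
      refine Finset.sum_le_sum fun i _ => ?_
      refine (mul_le_mul_of_nonneg_left (energyForm_le_of_mem_lowSpace (f i).2) (hr i).le).trans_eq
        ?_
      have := (s.r_pos i.2).ne'
      field_simp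
    have h0 : L f = 0 := (hf ()).resolve_right (not_lt.2 hle)
    have hE0 := hE f
    have hM0 := hM f
    rw [h0, map_zero, eq_comm, Finset.sum_eq_zero_iff_of_nonneg
      (fun (i : Finset.Icc 1 s.N) _ => mul_nonneg (hr i).le (energyForm_self_nonneg _))] at hE0
    rw [h0, map_zero, eq_comm, Finset.sum_eq_zero_iff_of_nonneg
      (fun (i : Finset.Icc 1 s.N) _ => mul_nonneg (s.m_pos i i.2).le (massForm_self_nonneg _ _))] at hM0
    funext i
    have := isProbabilityMeasure_restrictIcc S hab (subtree I i)
    refine Subtype.ext (eq_zero_of_mem_H1 (cantorMeasure S (subtree I i)) (hmem f i).1 ?_ ?_)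
    · exact (mul_eq_zero.1 (hE0 i (Finset.mem_univ i))).resolve_left (hr i).ne'
    · exact (mul_eq_zero.1 (hM0 i (Finset.mem_univ i))).resolve_left (s.m_pos i i.2).ne'

end SelfSimilar

end RecursiveCantor

theorem corollary4p7 {a b : ℝ} (hab : a < b) {J : Type*}
    (S : J → RecursiveCantor.WeightedIFS a b) (I : List ℕ → J) :
    Tendsto (RecursiveCantor.levelMeasure S I) atTop (𝓝 (RecursiveCantor.cantorMeasure S I)) ∧
    ∀ x : ℝ, 0 ≤ x →
      ∑ i ∈ Finset.Icc 1 (S (I [])).N,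
          RecursiveCantor.countD S (RecursiveCantor.subtree I i)
            ((S (I [])).r i * (S (I [])).m i * x)
        ≤ RecursiveCantor.countD S I x ∧
      RecursiveCantor.countD S I x ≤ RecursiveCantor.countN S I x ∧
      RecursiveCantor.countN S I x
        ≤ ∑ i ∈ Finset.Icc 1 (S (I [])).N,
          RecursiveCantor.countN S (RecursiveCantor.subtree I i)
            ((S (I [])).r i * (S (I [])).m i * x) :=
  ⟨RecursiveCantor.tendsto_levelMeasure S hab I, fun x _ =>
    ⟨RecursiveCantor.sum_countD_le S hab I x, RecursiveCantor.countD_le_countN S hab I x,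
      RecursiveCantor.countN_le_sum S hab I x⟩⟩
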